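/- Let $R$ be an integral domain with quotient field $K$ and complete integral closure $\widehat R=\{x\in K : \text{there is } 0\neq c\in R \text{ with } cx^n\in R \text{ for all } n\in\mathbb N\}$, and suppose that the conductor $(R:\widehat R)=\{x\in K : x\widehat R\subset R\}$ is nonzero. Let $r$ be an ideal system on $R$ all of whose $r$-ideals are ring ideals, that is, a map $X\mapsto X_r$ assigning to each subset $X\subset R$ an ideal $X_r$ of $R$ such that $X\subset X_r$; $X\subset Y_r$ implies $X_r\subset Y_r$; and $cX_r=(cX)_r$, for all $X,Y\subset R$ and $c\in R$. An ideal $I$ is an $r$-ideal if $I_r=I$. Let $\mathcal I_r(R)$ be the semigroup of nonzero $r$-ideals with multiplication $I\cdot_r J=(IJ)_r$; it has identity $R$ and is reduced. Assume that $R$ is $r$-Noetherian (the ascending chain condition holds for $r$-ideals), that the set $r\text{-}\max(R)$ of maximal elements of the set of proper nonzero $r$-ideals equals the set $\mathfrak X(R)$ of minimal nonzero prime ideals of $R$, and that only finitely many atoms $I$ of $\mathcal I_r(R)$ satisfy $\sqrt I\supset (R:\widehat R)$. Then $H=\mathcal I_r(R)$ is unit-cancellative ($a=au$ implies that $u$ is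 a unit) and atomic (each non-unit is a finite product of atoms), and the following hold. 1. $H$ has finite monotone catenary degree and finite successive distance. In particular, the catenary degree and the set of distances of $H$ are finite. 2. $H$ satisfies the Structure Theorem for Unions. Here the notions are the following. A factorization $z$ of $a\in H$ is a finite multiset of atoms with product $a$, $|z|$ is its cardinality, $\mathsf Z(a)$ is the set of factorizations of $a$, and $\mathsf L(a)=\{|z| : z\in\mathsf Z(a)\}$. The distance of two factorizations is $\mathsf d(z,z')=\max\{|z\setminus z'|,|z'\setminus z|\}$ (multiset difference). Two elements $k\ne\ell$ of $\mathsf L(a)$ are adjacent if no element of $\mathsf L(a)$ lies strictly between them, and the set of distances of $H$ consists of all $|k-\ell|$ with $k,\ell$ adjacent in some $\mathsf L(a)$. The catenary degree (respectively monotone catenary degree) of $H$ is the smallest $N\in\mathbb N_0\cup\{\infty\}$ such that for all $a\in H$ and $z,z'\in\mathsf Z(a)$ there are $z=z_0,z_1,\dots,z_k=z'$ in $\mathsf Z(a)$ with $\mathsf d(z_{i-1},z_i)\le N$ for all $i$ (respectively such that in addition $|z_0|\le\dots\le|z_k|$ or $|z_0|\ge\dots\ge|z_k|$). The successive distance of $H$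 is the smallest $N\in\mathbb N_0\cup\{\infty\}$ such that for all $a\in H$, $z\in\mathsf Z(a)$, and every $k$ adjacent to $|z|$ in $\mathsf L(a)$, there is $y\in\mathsf Z(a)$ with $|y|=k$ and $\mathsf d(z,y)\le N$. Let $\mathcal U_k(H)$ be the union of all sets $\mathsf L(a)$, $a\in H$, that contain $k$ (and $\mathcal U_k(H)=\{k\}$ if all elements of $H$ are units). The Structure Theorem for Unions holds for $H$ if there are $d\in\mathbb N$ and $M\in\mathbb N_0$ such that, for all sufficiently large $k$, $\mathcal U_k(H)=y_k+(L_k'\cup L_k^*\cup L_k'')\subset y_k+d\mathbb Z$, where $y_k\in\mathbb Z$, $L_k^*$ is a nonempty (finite or infinite) arithmetical progression with difference $d$ and $\min L_k^*=0$, $L_k'\subset[-M,-1]$, and $L_k''\subset\sup L_k^*+[1,M]$ (with $L_k''=\emptyset$ if $L_k^*$ is infinite). -/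

import Mathlib

/-! ### Ideal systems on a domain -/

/-- An ideal system `r` on a domain `R`, written as `X ↦ X_r = cl X`, all of whose `r`-ideals
are ring ideals (so that `cl` takes its values in `Ideal R`). The remaining axiom of an ideal
system, `c R ⊆ {c}_r`, as well as `0 ∈ X_r`, holds because `cl X` is a ring ideal containing `X`. -/
structure IdealSystem (R : Type*) [CommRing R] where
  /-- The closure operation `X ↦ X_r`. -/
  cl : Set R → Ideal R
  subset_cl : ∀ X : Set R, X ⊆ (cl X : Set R)
  cl_le_cl : ∀ X Y : Set R, X ⊆ (cl Y : Set R) → cl X ≤ cl Y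
  mul_cl : ∀ (c : R) (X : Set R),
    (fun x => c * x) '' (cl X : Set R) = (cl ((fun x => c * x) '' X) : Set R)

namespace IdealSystem

/-- `I` is an `r`-ideal: `I_r = I`. -/
def IsRIdeal {R : Type*} [CommRing R] (r : IdealSystem R) (I : Ideal R) : Prop :=
  r.cl (I : Set R) = I

/-- `R` is `r`-Noetherian: the ascending chain condition holds for `r`-ideals. -/
def IsRNoetherian {R : Type*} [CommRing R] (r : IdealSystem R) : Prop :=
  ∀ f : ℕ →o Ideal R, (∀ n, r.IsRIdeal (f n)) → ∃ n, ∀ m, n ≤ m → f n = f m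

/-- `r`-`max(R)`: the maximal elements, with respect to inclusion, of the set of proper nonzero
`r`-ideals of `R`. -/
def rMax {R : Type*} [CommRing R] (r : IdealSystem R) : Set (Ideal R) :=
  {M | Maximal (fun I : Ideal R => r.IsRIdeal I ∧ I ≠ ⊥ ∧ I ≠ ⊤) M}

/-- The set `𝓘_r(R)` of nonzero `r`-ideals of `R`. -/
def NonzeroRIdeal {R : Type*} [CommRing R] (r : IdealSystem R) : Type _ :=
  {I : Ideal R // I ≠ ⊥ ∧ r.IsRIdeal I}

theorem cl_cl {R : Type*} [CommRing R] (r : IdealSystem R) (X : Set R) :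
    r.cl (r.cl X : Set R) = r.cl X :=
  le_antisymm (r.cl_le_cl _ _ subset_rfl) (r.cl_le_cl _ _ ((r.subset_cl X).trans (r.subset_cl _)))

theorem le_cl {R : Type*} [CommRing R] (r : IdealSystem R) (I : Ideal R) :
    I ≤ r.cl (I : Set R) := r.subset_cl _

theorem cl_top {R : Type*} [CommRing R] (r : IdealSystem R) :
    r.cl ((⊤ : Ideal R) : Set R) = ⊤ := top_le_iff.1 (r.le_cl ⊤)

theorem cl_mul_cl {R : Type*} [CommRing R] (r : IdealSystem R) (I J : Ideal R) :
    r.cl ((I * r.cl (J : Set R) : Ideal R) : Set R) = r.cl ((I * J : Ideal R) : Set R) := by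
  apply le_antisymm
  · apply r.cl_le_cl
    change I * r.cl (J : Set R) ≤ r.cl ((I * J : Ideal R) : Set R)
    rw [Ideal.mul_le]
    intro a ha b hb
    have h1 : a * b ∈ (fun x => a * x) '' (r.cl (J : Set R) : Set R) := ⟨b, hb, rfl⟩
    rw [r.mul_cl] at h1
    refine r.cl_le_cl _ _ ?_ h1
    rintro _ ⟨x, hx, rfl⟩
    exact r.le_cl _ (Ideal.mul_mem_mul ha hx)
  · apply r.cl_le_cl
    exact (Ideal.mul_mono_right (r.le_cl J)).trans (r.le_cl _)

/-- `r`-multiplication `I ·_r J = (IJ)_r` on `𝓘_r(R)`. -/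
instance {R : Type*} [CommRing R] [IsDomain R] (r : IdealSystem R) : Mul r.NonzeroRIdeal where
  mul I J := ⟨r.cl ((I.1 * J.1 : Ideal R) : Set R), fun h =>
    (mul_ne_zero I.2.1 J.2.1 : I.1 * J.1 ≠ 0)
      (le_bot_iff.1 ((r.le_cl (I.1 * J.1)).trans (le_of_eq h))), r.cl_cl _⟩

/-- The identity element of `𝓘_r(R)` is `R`. -/
instance {R : Type*} [CommRing R] [IsDomain R] (r : IdealSystem R) : One r.NonzeroRIdeal where
  one := ⟨⊤, top_ne_bot, r.cl_top⟩

theorem coe_mul {R : Type*} [CommRing R] [IsDomain R] (r : IdealSystem R)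
    (I J : r.NonzeroRIdeal) : (I * J).1 = r.cl ((I.1 * J.1 : Ideal R) : Set R) := rfl

theorem coe_one {R : Type*} [CommRing R] [IsDomain R] (r : IdealSystem R) :
    (1 : r.NonzeroRIdeal).1 = ⊤ := rfl

/-- The commutative semigroup with identity `𝓘_r(R)` of nonzero `r`-ideals with
`r`-multiplication. -/
instance {R : Type*} [CommRing R] [IsDomain R] (r : IdealSystem R) :
    CommMonoid r.NonzeroRIdeal where
  mul_assoc I J K := Subtype.ext <| by
    rw [coe_mul, coe_mul, coe_mul, coe_mul, cl_mul_cl, mul_comm, cl_mul_cl, mul_comm, mul_assoc]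
  mul_comm I J := Subtype.ext <| by rw [coe_mul, coe_mul, mul_comm]
  one_mul I := Subtype.ext <| by
    rw [coe_mul, coe_one, ← Ideal.one_eq_top, one_mul]; exact I.2.2
  mul_one I := Subtype.ext <| by
    rw [coe_mul, coe_one, ← Ideal.one_eq_top, mul_one]; exact I.2.2

/-- The monoid `𝓘_r(R)` is reduced: `R` is its only invertible element. -/
instance {R : Type*} [CommRing R] [IsDomain R] (r : IdealSystem R) :
    Subsingleton (r.NonzeroRIdeal)ˣ := by
  have key : ∀ u : (r.NonzeroRIdeal)ˣ, u = 1 := fun u => by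
    apply Units.ext
    apply Subtype.ext
    have h := congrArg Subtype.val u.mul_inv
    rw [coe_mul, coe_one] at h
    rw [Units.val_one, coe_one, ← top_le_iff, ← h]
    have h2 := r.cl_le_cl (((u : r.NonzeroRIdeal).1 * ((u⁻¹ : (r.NonzeroRIdeal)ˣ) :
      r.NonzeroRIdeal).1 : Ideal R) : Set R) ((u : r.NonzeroRIdeal).1 : Set R)
      (Ideal.mul_le_left.trans (r.le_cl _))
    exact h2.trans (le_of_eq (u : r.NonzeroRIdeal).2.2)
  exact ⟨fun u v => (key u).trans (key v).symm⟩

end IdealSystem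

/-- `𝔛(R)`: the set of minimal nonzero prime ideals of the domain `R`. -/
def minimalNonzeroPrimes (R : Type*) [CommRing R] : Set (Ideal R) :=
  {P | Minimal (fun Q : Ideal R => Q.IsPrime ∧ Q ≠ ⊥) P}

/-- The conductor `(R : R̂) = {x ∈ K | x R̂ ⊆ R}`, where `K` is the quotient field of `R` and `R̂`
is the complete integral closure of `R` in `K`. As `1 ∈ R̂`, it is contained in `R`, and it is
regarded as an ideal of `R`. -/
noncomputable def completeConductor (R : Type*) [CommRing R] : Ideal R :=
  Submodule.comap (Algebra.linearMap R (FractionRing R))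
    ((1 : Submodule R (FractionRing R)) /
      Subalgebra.toSubmodule (completeIntegralClosure R (FractionRing R)))

/-! ### Arithmetic of reduced monoids

Below, `H` is a reduced commutative semigroup with identity, so that `H = H_red`. The atoms of
`H` are its `Irreducible` elements, and elements of the factorization monoid `Z(H)`, the free
abelian monoid on the atoms, are finite multisets of atoms; the length of a factorization is its
cardinality. -/

namespace Factorization

/-- `H` is unit-cancellative: `a = a u` implies that `u` is a unit. -/
def IsUnitCancellative (H : Type*) [CommMonoid H] : Prop :=
  ∀ a u : H, a = a * u → IsUnit u

/-- The set `Z(a)` of factorizations of `a` into atoms. -/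
def factorizations {H : Type*} [CommMonoid H] (a : H) : Set (Multiset H) :=
  {z | (∀ u ∈ z, Irreducible u) ∧ z.prod = a}

/-- `H` is atomic: every non-unit is a finite product of atoms. -/
def IsAtomic (H : Type*) [CommMonoid H] : Prop :=
  ∀ a : H, ¬ IsUnit a → (factorizations a).Nonempty

/-- The set of lengths `L(a)`. -/
def lengths {H : Type*} [CommMonoid H] (a : H) : Set ℕ :=
  Multiset.card '' factorizations a

/-- `k` and `l` are adjacent elements of `L`. -/
def Adjacent (L : Set ℕ) (k l : ℕ) : Prop :=
  k ≠ l ∧ L ∩ Set.Icc (min k l) (max k l) = {k, l}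

/-- The set of distances `Δ(H)`: all `|l - k|` for adjacent lengths `k`, `l` of an element. -/
def distances (H : Type*) [CommMonoid H] : Set ℕ :=
  {d | ∃ (a : H) (k l : ℕ), Adjacent (lengths a) k l ∧ d = max k l - min k l}

open Classical in
/-- The distance `d(z, z') = max {|z gcd(z,z')⁻¹|, |z' gcd(z,z')⁻¹|}` of two factorizations.
(For multisets, `z - z'` is `z` with the common part `z ∩ z'` removed.) -/
noncomputable def dist {H : Type*} (z z' : Multiset H) : ℕ :=
  max (Multiset.card (z - z')) (Multiset.card (z' - z))

/-- `z` and `z'` can be concatenated by an `N`-chain of factorizations of `a`. -/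
def HasChain {H : Type*} [CommMonoid H] (a : H) (N : ℕ∞) (z z' : Multiset H) : Prop :=
  ∃ (k : ℕ) (f : ℕ → Multiset H), f 0 = z ∧ f k = z' ∧
    (∀ i ≤ k, f i ∈ factorizations a) ∧ (∀ i < k, (dist (f i) (f (i + 1)) : ℕ∞) ≤ N)

/-- `z` and `z'` can be concatenated by a monotone `N`-chain of factorizations of `a`. -/
def HasMonotoneChain {H : Type*} [CommMonoid H] (a : H) (N : ℕ∞) (z z' : Multiset H) : Prop :=
  ∃ (k : ℕ) (f : ℕ → Multiset H), f 0 = z ∧ f k = z' ∧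
    (∀ i ≤ k, f i ∈ factorizations a) ∧ (∀ i < k, (dist (f i) (f (i + 1)) : ℕ∞) ≤ N) ∧
    ((∀ i < k, Multiset.card (f i) ≤ Multiset.card (f (i + 1))) ∨
      (∀ i < k, Multiset.card (f (i + 1)) ≤ Multiset.card (f i)))

/-- The catenary degree `c(a)` of an element. -/
noncomputable def catenaryDegreeAt {H : Type*} [CommMonoid H] (a : H) : ℕ∞ :=
  sInf {N | ∀ z ∈ factorizations a, ∀ z' ∈ factorizations a, HasChain a N z z'}

/-- The monotone catenary degree `c_mon(a)` of an element. -/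
noncomputable def monotoneCatenaryDegreeAt {H : Type*} [CommMonoid H] (a : H) : ℕ∞ :=
  sInf {N | ∀ z ∈ factorizations a, ∀ z' ∈ factorizations a, HasMonotoneChain a N z z'}

/-- The catenary degree `c(H)`. -/
noncomputable def catenaryDegree (H : Type*) [CommMonoid H] : ℕ∞ :=
  ⨆ a : H, catenaryDegreeAt a

/-- The monotone catenary degree `c_mon(H)`. -/
noncomputable def monotoneCatenaryDegree (H : Type*) [CommMonoid H] : ℕ∞ :=
  ⨆ a : H, monotoneCatenaryDegreeAt a

/-- `δ(z)` for a factorization `z` of `a`: the smallest `N` such that for every length `k` of `a`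
adjacent to `|z|` there is a factorization `y` of `a` of length `k` with `d(z, y) ≤ N`. -/
noncomputable def successiveDistanceAt {H : Type*} [CommMonoid H] (a : H) (z : Multiset H) : ℕ∞ :=
  sInf {N | ∀ k : ℕ, Adjacent (lengths a) k (Multiset.card z) →
    ∃ y ∈ factorizations a, Multiset.card y = k ∧ (dist z y : ℕ∞) ≤ N}

/-- The (strong) successive distance `δ(H)`, the supremum of `δ(z)` over all factorizations `z`. -/
noncomputable def successiveDistance (H : Type*) [CommMonoid H] : ℕ∞ :=
  ⨆ a : H, ⨆ z ∈ factorizations a, successiveDistanceAt a z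

/-- The union `𝓤_k(H)` of all sets of lengths containing `k`; by convention it is `{k}` if `H`
consists of units only. -/
def unionOfLengths (H : Type*) [CommMonoid H] (k : ℕ) : Set ℕ :=
  {l | ((∀ a : H, IsUnit a) ∧ l = k) ∨
    ((∃ a : H, ¬ IsUnit a) ∧ ∃ a : H, k ∈ lengths a ∧ l ∈ lengths a)}

/-- The Structure Theorem for Unions holds for `H`: there are `d ≥ 1` and `M ≥ 0` such that for
all sufficiently large `k` one has `𝓤_k(H) = y + (L' ∪ L ∪ L'') ⊆ y + d ℤ`, where `L` is a
nonempty (finite or infinite) arithmetical progression with difference `d` and minimum `0`,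
`L' ⊆ [-M, -1]`, and `L'' ⊆ sup L + [1, M]`, with `L'' = ∅` if `L` is infinite. -/
def StructureTheoremForUnions (H : Type*) [CommMonoid H] : Prop :=
  ∃ d : ℕ, 0 < d ∧ ∃ M : ℕ, ∃ k₀ : ℕ, ∀ k : ℕ, k₀ ≤ k →
    ∃ (y : ℤ) (L' L L'' : Set ℤ),
      (fun n : ℕ => (n : ℤ)) '' unionOfLengths H k = (fun x => y + x) '' (L' ∪ L ∪ L'') ∧
      (∀ x ∈ L' ∪ L ∪ L'', (d : ℤ) ∣ x) ∧
      L' ⊆ Set.Icc (-(M : ℤ)) (-1) ∧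
      ((∃ n : ℕ, L = {x | ∃ i : ℕ, i ≤ n ∧ x = (d : ℤ) * i} ∧
          L'' ⊆ Set.Icc ((d : ℤ) * n + 1) ((d : ℤ) * n + M)) ∨
        (L = {x | ∃ i : ℕ, x = (d : ℤ) * i} ∧ L'' = ∅))

end Factorization

/-! Two facts about the monoid `H` of nonzero `r`-ideals carry the proof.

*All but finitely many atoms of `H` are cancellative prime elements.* Let `I` be an atom whose
radical does not contain the conductor, and `Q` a minimal prime over `I` which does not contain it
either. Then `Q` is an `r`-ideal, so `Q` is a height-one prime and a maximal `r`-ideal. If `Q` were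
not `r`-invertible, then `Q Q⁻¹ ⊆ Q`, so `Q⁻¹` would consist of almost integral elements and an
element `c ∉ Q` of the conductor would satisfy `c Q⁻¹ ⊆ R`. This contradicts the fact that, locally
at `Q`, some power of `Q` lies in a given nonzero principal ideal
(`IdealSystem.IsRNoetherian.exists_cl_mul_eq_span_singleton`). Being `r`-invertible, `Q` divides
`I`, whence `I = Q`, and `Q` is prime in `H`. The same fact on powers of height-one primes replaces
Nakayama's lemma in the proof that `H` is unit-cancellative; atomicity then follows from the
ascending chain condition.

*Factorizations over a finite set `E` of atoms are controlled by Dickson's lemma.* By the first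
fact, the atoms outside `E` occur with the same multiplicity in all factorizations of an element, so
only multisets over `E` matter. For a translation-invariant relation `s` on multisets, those
multisets that can be replaced by an `s`-related one with the same product form an upward closed
set; its finitely many minimal elements bound the size of such replacements
(`Factorization.PrimeOutside.exists_bounded_move`). Taking for `s` the relations `|x| < |y|`,
`|y| = |x| + d`, `|x| = |y| + d` bounds the distances and the successive distance. Taking for `s`
the descent in a translation-invariant well-order among multisets of equal length shows that all
factorizations of the same length are linked to the least one, which bounds the monotone catenary
degree.

For the Structure Theorem for Unions, let `W` be the set of pairs of lengths `(k, l)` of a common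
element. It is a symmetric submonoid of `ℕ × ℕ` containing the diagonal. The pairs of multisets over
`E` with equal images in the quotient group of `H` are closed under differences, hence generated by
finitely many, and one of them attains the maximal quotient of lengths `h / g`. Thus `W` lies in
the cone of slope `h / g` and contains a translate of the multiples of `(g, h)`; together with one
pair `(k₀, k₀ + d) ∈ W`, where `d` generates the group of all differences `l - k`, this produces
a diagonal translate of all points of the cone with `l ≡ k` modulo `d`
(`Factorization.exists_progression_of_cone`). The unions of sets of lengths are the fibres of
`W`. -/

/-! ### Closure computations for an ideal system -/

namespace IdealSystem

variable {R : Type*} [CommRing R] {r : IdealSystem R}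

theorem cl_mono {X Y : Set R} (h : X ⊆ Y) : r.cl X ≤ r.cl Y :=
  r.cl_le_cl _ _ (h.trans (r.subset_cl _))

theorem IsRIdeal.cl_le {C : Ideal R} (hC : r.IsRIdeal C) {X : Set R} (h : X ⊆ C) :
    r.cl X ≤ C :=
  (cl_mono h).trans hC.le

theorem cl_span (X : Set R) : r.cl (Ideal.span X : Set R) = r.cl X :=
  le_antisymm (r.cl_le_cl _ _ (Ideal.span_le.2 (r.subset_cl X))) (cl_mono Ideal.subset_span)

/-- An `r`-ideal contains `A * B_r` as soon as it contains `A * B`. -/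
theorem IsRIdeal.mul_cl_le {C : Ideal R} (hC : r.IsRIdeal C) {A B : Ideal R} (h : A * B ≤ C) :
    A * r.cl (B : Set R) ≤ C :=
  (r.le_cl _).trans ((r.cl_mul_cl A B).le.trans (hC.cl_le h))

theorem IsRIdeal.mul_cl_pow_le {C : Ideal R} (hC : r.IsRIdeal C) {B : Ideal R} (n : ℕ)
    {A : Ideal R} (h : A * B ^ n ≤ C) : A * r.cl (B : Set R) ^ n ≤ C := by
  induction n generalizing A with
  | zero => simpa using h
  | succ n ih =>
    have h1 : (A * B ^ n) * r.cl (B : Set R) ≤ C :=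
      hC.mul_cl_le (by rwa [mul_assoc, ← pow_succ])
    rw [mul_right_comm] at h1
    have h2 := ih h1
    rwa [mul_assoc, ← pow_succ'] at h2

theorem coe_span_singleton_mul (c : R) (I : Ideal R) :
    ((Ideal.span {c} * I : Ideal R) : Set R) = (fun x => c * x) '' (I : Set R) := by
  ext x
  simp [Ideal.mem_span_singleton_mul]

theorem cl_span_singleton_mul (c : R) (I : Ideal R) :
    r.cl ((Ideal.span {c} * I : Ideal R) : Set R) = Ideal.span {c} * r.cl (I : Set R) := by
  apply SetLike.coe_injective
  rw [coe_span_singleton_mul, coe_span_singleton_mul, r.mul_cl]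

theorem isRIdeal_span_singleton (c : R) : r.IsRIdeal (Ideal.span {c}) := by
  have h := r.cl_span_singleton_mul c ⊤
  rwa [r.cl_top, Ideal.mul_top] at h

/-- The residual `(C : A)` of an `r`-ideal is an `r`-ideal. -/
theorem IsRIdeal.of_mul_le_iff {C A J : Ideal R} (hC : r.IsRIdeal C)
    (hJ : ∀ B : Ideal R, B ≤ J ↔ A * B ≤ C) : r.IsRIdeal J :=
  le_antisymm ((hJ _).2 (hC.mul_cl_le ((hJ J).1 le_rfl))) (r.le_cl J)

/-- If an `r`-ideal is contained in `aR`, then dividing it by `a` gives an `r`-ideal. -/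
theorem IsRIdeal.exists_eq_span_singleton_mul [IsDomain R] {I : Ideal R} (hI : r.IsRIdeal I)
    {a : R} (ha : a ≠ 0) (h : I ≤ Ideal.span {a}) :
    ∃ C, r.IsRIdeal C ∧ I = Ideal.span {a} * C := by
  have hIC : I = Ideal.span {a} * I.colon {a} := by
    refine le_antisymm (fun x hx => ?_) (Ideal.span_singleton_mul_le_iff.2 fun z hz => ?_)
    · obtain ⟨y, rfl⟩ := Ideal.mem_span_singleton'.1 (h hx)
      refine Ideal.mem_span_singleton_mul.2 ⟨y, ?_, mul_comm _ _⟩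
      rwa [Submodule.mem_colon_singleton]
    · rwa [Submodule.mem_colon_singleton, smul_eq_mul, mul_comm] at hz
  refine ⟨I.colon {a}, ?_, hIC⟩
  have h1 : r.cl (I : Set R) = I := hI
  rw [hIC, cl_span_singleton_mul, ← hIC] at h1
  nth_rw 2 [hIC] at h1
  exact (Ideal.span_singleton_mul_right_inj ha).1 h1

/-! ### The ascending chain condition on `r`-ideals -/

theorem IsRNoetherian.wellFoundedGT (h : r.IsRNoetherian) :
    WellFoundedGT {I : Ideal R // r.IsRIdeal I} := by
  rw [wellFoundedGT_iff_monotone_chain_condition]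
  intro f
  obtain ⟨n, hn⟩ := h ⟨fun n => (f n).1, fun _ _ hij => f.monotone hij⟩ fun n => (f n).2
  exact ⟨n, fun m hm => Subtype.ext (hn m hm)⟩

theorem IsRNoetherian.exists_maximal (h : r.IsRNoetherian) {p : Ideal R → Prop}
    (hp : ∀ I, p I → r.IsRIdeal I) {I : Ideal R} (hI : p I) : ∃ J, I ≤ J ∧ Maximal p J := by
  have := h.wellFoundedGT
  obtain ⟨J, hIJ, hJ⟩ := exists_maximal_ge_of_wellFoundedGT
    (fun J : {I : Ideal R // r.IsRIdeal I} => p J.1) ⟨I, hp I hI⟩ hI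
  exact ⟨J.1, hIJ, hJ.1, fun K hK hJK => hJ.2 (y := ⟨K, hp K hK⟩) hK hJK⟩

/-- In an `r`-Noetherian domain every closure is the closure of a finite subset; in particular the
ideal system is automatically finitary. -/
theorem IsRNoetherian.exists_finset (h : r.IsRNoetherian) (X : Set R) :
    ∃ F : Finset R, (F : Set R) ⊆ X ∧ r.cl (F : Set R) = r.cl X := by
  classical
  obtain ⟨J, -, ⟨F, hF, rfl⟩, hmax⟩ := h.exists_maximal
    (p := fun I => ∃ F : Finset R, (F : Set R) ⊆ X ∧ r.cl (F : Set R) = I)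
    (by rintro _ ⟨F, -, rfl⟩; exact r.cl_cl _) ⟨∅, by simp, rfl⟩
  refine ⟨F, hF, le_antisymm (cl_mono hF) (r.cl_le_cl _ _ fun x hx => ?_)⟩
  have h1 := hmax (y := r.cl (insert x F : Finset R))
    ⟨insert x F, by simpa [Set.insert_subset_iff] using ⟨hx, hF⟩, rfl⟩ (cl_mono (by simp))
  exact h1 (r.subset_cl _ (by simp))

end IdealSystem

/-! ### Minimal primes over `r`-ideals -/

namespace Ideal

variable {R : Type*} [CommRing R]

theorem exists_mul_pow_mem_of_mem_minimalPrimes {I Q : Ideal R} (hQ : Q ∈ I.minimalPrimes)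
    {m : R} (hm : m ∈ Q) : ∃ s ∉ Q, ∃ n : ℕ, s * m ^ n ∈ I := by
  have := hQ.1.1
  by_contra! hcon
  obtain ⟨p, hp, hIp, hdisj⟩ := Ideal.exists_le_prime_disjoint I
    (Q.primeCompl ⊔ Submonoid.powers m) (by
      rw [Set.disjoint_left]
      intro x hxI hx
      obtain ⟨s, hs, _, ⟨n, rfl⟩, rfl⟩ := Submonoid.mem_sup.1 hx
      exact hcon s hs n hxI)
  rw [Set.disjoint_left] at hdisj
  have hpQ : p ≤ Q := fun x hx => by
    by_contra hxQ
    exact hdisj hx (Submonoid.mem_sup_left (show x ∈ Q.primeCompl from hxQ))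
  exact hdisj (hQ.2 ⟨hp, hIp⟩ hpQ hm) (Submonoid.mem_sup_right (Submonoid.mem_powers m))

/-- A finitely generated ideal contained in a minimal prime `Q` over `I` is nilpotent modulo `I`
locally at `Q`. -/
theorem exists_span_singleton_mul_pow_le {I Q : Ideal R} (hQ : Q ∈ I.minimalPrimes)
    (F : Finset R) (hF : (F : Set R) ⊆ Q) :
    ∃ s ∉ Q, ∃ n : ℕ, Ideal.span {s} * Ideal.span (F : Set R) ^ n ≤ I := by
  classical
  have hQp := hQ.1.1
  have key : ∃ s ∉ Q, Ideal.span (F : Set R) ≤ (I.colon {s}).radical := by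
    induction F using Finset.induction_on with
    | empty => exact ⟨1, hQp.one_notMem, by simp⟩
    | insert x F hx ih =>
      rw [Finset.coe_insert, Set.insert_subset_iff] at hF
      obtain ⟨s, hs, h⟩ := ih hF.2
      obtain ⟨t, ht, n, hn⟩ := exists_mul_pow_mem_of_mem_minimalPrimes hQ hF.1
      refine ⟨s * t, hQp.mul_notMem hs ht, ?_⟩
      rw [Finset.coe_insert, Ideal.span_le, Set.insert_subset_iff]
      refine ⟨⟨n, ?_⟩, fun y hy => ?_⟩
      · rw [Submodule.mem_colon_singleton, smul_eq_mul]
        have := I.mul_mem_left s hn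
        convert this using 1; ring
      · obtain ⟨k, hk⟩ := h (Ideal.subset_span hy)
        refine ⟨k, ?_⟩
        rw [Submodule.mem_colon_singleton, smul_eq_mul] at hk ⊢
        have := I.mul_mem_left t hk
        convert this using 1; ring
  obtain ⟨s, hs, h⟩ := key
  obtain ⟨n, hn⟩ := Ideal.exists_pow_le_of_le_radical_of_fg h ⟨F, rfl⟩
  refine ⟨s, hs, n, Ideal.span_singleton_mul_le_iff.2 fun z hz => ?_⟩
  have := hn hz
  rwa [Submodule.mem_colon_singleton, smul_eq_mul, mul_comm] at this

theorem mem_minimalPrimes_span_singleton {P : Ideal R} (hP : P ∈ minimalNonzeroPrimes R) {a : R}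
    (ha : a ≠ 0) (haP : a ∈ P) : P ∈ (Ideal.span {a}).minimalPrimes := by
  refine ⟨⟨hP.1.1, by simpa [Ideal.span_le] using haP⟩, fun Q hQ hQP => hP.2 ⟨hQ.1, ?_⟩ hQP⟩
  rintro rfl
  exact ha (by simpa using hQ.2)

end Ideal

namespace IdealSystem

variable {R : Type*} [CommRing R] {r : IdealSystem R}

theorem IsRNoetherian.isRIdeal_of_mem_minimalPrimes (h : r.IsRNoetherian) {I Q : Ideal R}
    (hI : r.IsRIdeal I) (hQ : Q ∈ I.minimalPrimes) : r.IsRIdeal Q := by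
  obtain ⟨F, hF, hFQ⟩ := h.exists_finset (Q : Set R)
  obtain ⟨s, hs, n, hn⟩ := Ideal.exists_span_singleton_mul_pow_le hQ F hF
  have h1 := (hI.mul_cl_pow_le n hn).trans hQ.1.2
  rw [cl_span, hFQ, hQ.1.1.mul_le] at h1
  have := hQ.1.1
  exact le_antisymm (Ideal.IsPrime.le_of_pow_le
    (h1.resolve_left fun h => hs (h (Ideal.mem_span_singleton_self s)))) (r.le_cl Q)

/-- The `r`-ideal `Q` need not be finitely generated as a ring ideal, but a power of it is still
contained in `I` locally at `Q`. -/
theorem IsRNoetherian.exists_span_singleton_mul_pow_le (h : r.IsRNoetherian) {I Q : Ideal R}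
    (hI : r.IsRIdeal I) (hQ : Q ∈ I.minimalPrimes) :
    ∃ s ∉ Q, ∃ n : ℕ, Ideal.span {s} * Q ^ n ≤ I := by
  obtain ⟨F, hF, hFQ⟩ := h.exists_finset (Q : Set R)
  obtain ⟨s, hs, n, hn⟩ := Ideal.exists_span_singleton_mul_pow_le hQ F hF
  refine ⟨s, hs, n, ?_⟩
  have h1 := hI.mul_cl_pow_le n hn
  rwa [cl_span, hFQ, h.isRIdeal_of_mem_minimalPrimes hI hQ] at h1

theorem IsRNoetherian.exists_le_mem_rMax (h : r.IsRNoetherian) {I : Ideal R} (hI : r.IsRIdeal I)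
    (h0 : I ≠ ⊥) (h1 : I ≠ ⊤) : ∃ M ∈ r.rMax, I ≤ M := by
  obtain ⟨M, hIM, hM⟩ := h.exists_maximal (p := fun I => r.IsRIdeal I ∧ I ≠ ⊥ ∧ I ≠ ⊤)
    (fun I hI => hI.1) ⟨hI, h0, h1⟩
  exact ⟨M, hM, hIM⟩

end IdealSystem

/-! ### Invertibility of height-one primes not containing the conductor -/

/-- If `P * J ⊆ a P`, then every quotient `j / a` with `j ∈ J` is almost integral, so that the
conductor multiplies `J` into `a R`. -/
theorem mul_mem_span_singleton_of_mem_completeConductor {R : Type*} [CommRing R] [IsDomain R]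
    {c : R} (hc : c ∈ completeConductor R) {P J : Ideal R} (hP : P ≠ ⊥) {a : R} (ha : a ≠ 0)
    (h : P * J ≤ Ideal.span {a} * P) {j : R} (hj : j ∈ J) : c * j ∈ Ideal.span {a} := by
  set K := FractionRing R
  have ha' : algebraMap R K a ≠ 0 := by simpa using ha
  have hx : algebraMap R K j / algebraMap R K a ∈ completeIntegralClosure R K := by
    rw [mem_completeIntegralClosure]
    obtain ⟨p, hp, hp0⟩ := Submodule.exists_mem_ne_zero_of_ne_bot hP
    refine ⟨p, mem_nonZeroDivisors_of_ne_zero hp0, fun n => ?_⟩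
    have key : ∃ q ∈ P, algebraMap R K q = p • (algebraMap R K j / algebraMap R K a) ^ n := by
      induction n with
      | zero => exact ⟨p, hp, by simp [Algebra.smul_def]⟩
      | succ n ih =>
        obtain ⟨q, hq, hqn⟩ := ih
        obtain ⟨q', hq', hqj⟩ := Ideal.mem_span_singleton_mul.1 (h (Ideal.mul_mem_mul hq hj))
        refine ⟨q', hq', ?_⟩
        rw [pow_succ, ← smul_mul_assoc, ← hqn, mul_div_assoc', eq_div_iff ha', ← map_mul,
          ← map_mul, ← hqj, mul_comm]
    obtain ⟨q, -, hq⟩ := key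
    exact ⟨q, hq⟩
  have hc' : algebraMap R K c ∈ (1 : Submodule R K) /
      Subalgebra.toSubmodule (completeIntegralClosure R K) := hc
  obtain ⟨y, hy⟩ := Submodule.mem_one.1 (Submodule.mem_div_iff_forall_mul_mem.1 hc' _ hx)
  rw [mul_div_assoc', eq_div_iff ha', ← map_mul, ← map_mul] at hy
  exact Ideal.mem_span_singleton'.2 ⟨y, FaithfulSMul.algebraMap_injective R K hy⟩

namespace IdealSystem

variable {R : Type*} [CommRing R] [IsDomain R] {r : IdealSystem R}

/-- A height-one prime which is a maximal `r`-ideal and does not contain the conductor is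
`r`-invertible. -/
theorem IsRNoetherian.exists_cl_mul_eq_span_singleton (h : r.IsRNoetherian) {P : Ideal R}
    (hP : P ∈ minimalNonzeroPrimes R) (hPmax : P ∈ r.rMax) (hc : ¬ completeConductor R ≤ P) :
    ∃ a ≠ 0, ∃ J : Ideal R, r.IsRIdeal J ∧ J ≠ ⊥ ∧
      r.cl ((P * J : Ideal R) : Set R) = Ideal.span {a} := by
  classical
  have hPp := hP.1.1
  obtain ⟨a, haP, ha⟩ := Submodule.exists_mem_ne_zero_of_ne_bot hP.1.2
  let J : Ideal R := (Ideal.span {a}).colon (P : Set R)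
  have hJ : ∀ B : Ideal R, B ≤ J ↔ P * B ≤ Ideal.span {a} := fun B => by
    rw [mul_comm, Ideal.mul_le]
    exact forall₂_congr fun b _ => Submodule.mem_colon
  have haJ : a ∈ J := by
    rw [← Ideal.span_singleton_le_iff_mem, hJ]
    exact Ideal.mul_le_right
  have hJr : r.IsRIdeal J := (isRIdeal_span_singleton a).of_mul_le_iff hJ
  refine ⟨a, ha, J, hJr, fun h0 => ha (by simpa [h0] using haJ), ?_⟩
  obtain ⟨C, hC, hPJ⟩ := IsRIdeal.exists_eq_span_singleton_mul (r := r) (r.cl_cl _) ha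
    ((isRIdeal_span_singleton a).cl_le ((hJ J).1 le_rfl))
  rw [hPJ]
  suffices hCtop : C = ⊤ by rw [hCtop, Ideal.mul_top]
  by_contra hCtop
  have hPC : P ≤ C := by
    rw [← Ideal.span_singleton_mul_right_mono ha, ← hPJ, mul_comm]
    exact (Ideal.mul_mono_right ((Ideal.span_singleton_le_iff_mem _).2 haJ)).trans (r.le_cl _)
  have hCP : C = P := le_antisymm
    (hPmax.2 ⟨hC, fun h0 => hP.1.2 (le_bot_iff.1 (h0 ▸ hPC)), hCtop⟩ hPC) hPC
  obtain ⟨c, hc, hcP⟩ := SetLike.not_le_iff_exists.1 hc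
  have hcJ : ∀ j ∈ J, c * j ∈ Ideal.span {a} := fun j hj =>
    mul_mem_span_singleton_of_mem_completeConductor hc hP.1.2 ha
      (by rw [← hCP, ← hPJ, hCP]; exact r.le_cl _) hj
  -- Multiplying by the conductor lowers the least exponent `n` with `s P ^ n ⊆ a R`, `s ∉ P`.
  have hex : ∃ n : ℕ, ∃ s ∉ P, Ideal.span {s} * P ^ n ≤ Ideal.span {a} := by
    obtain ⟨s, hs, n, hn⟩ := h.exists_span_singleton_mul_pow_le (isRIdeal_span_singleton a)
      (Ideal.mem_minimalPrimes_span_singleton hP ha haP)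
    exact ⟨n, s, hs, hn⟩
  obtain ⟨s, hs, hn⟩ := Nat.find_spec hex
  have haP' : Ideal.span {a} ≤ P := (Ideal.span_singleton_le_iff_mem _).2 haP
  cases hk : Nat.find hex with
  | zero =>
    rw [hk, pow_zero, mul_one] at hn
    exact hs (haP' (hn (Ideal.mem_span_singleton_self s)))
  | succ k =>
    refine Nat.find_min hex (m := k) (by omega) ⟨c * s, hPp.mul_notMem hcP hs, ?_⟩
    have h1 : Ideal.span {s} * P ^ k ≤ J := by
      rwa [hJ, mul_left_comm, ← pow_succ', ← hk]
    rw [← Ideal.span_singleton_mul_span_singleton, mul_assoc]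
    exact Ideal.span_singleton_mul_le_iff.2 fun j hj => hcJ j (h1 hj)

/-! ### The monoid of nonzero `r`-ideals -/

namespace NonzeroRIdeal

theorem coe_mul_le_left (I J : r.NonzeroRIdeal) : (I * J).1 ≤ I.1 :=
  IsRIdeal.cl_le I.2.2 (Ideal.mul_le_left (I := I.1))

theorem isUnit_iff {I : r.NonzeroRIdeal} : IsUnit I ↔ I.1 = ⊤ := by
  rw [isUnit_iff_eq_one]
  exact ⟨fun h => h ▸ r.coe_one, fun h => Subtype.ext (h.trans r.coe_one.symm)⟩

/-- The principal ideal `aR` as an element of the monoid of nonzero `r`-ideals. -/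
def principal (r : IdealSystem R) (a : R) (ha : a ≠ 0) : r.NonzeroRIdeal :=
  ⟨Ideal.span {a}, by simpa using ha, isRIdeal_span_singleton a⟩

theorem coe_principal_mul {a : R} (ha : a ≠ 0) (I : r.NonzeroRIdeal) :
    (principal r a ha * I).1 = Ideal.span {a} * I.1 := by
  rw [coe_mul, principal, cl_span_singleton_mul, I.2.2]

theorem principal_mul_left_injective {a : R} (ha : a ≠ 0) :
    Function.Injective (principal r a ha * ·) := fun I J hIJ => by
  have h := congrArg Subtype.val hIJ
  simp only [coe_principal_mul] at h
  exact Subtype.ext ((Ideal.span_singleton_mul_right_inj ha).1 h)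

/-- `I = I ·_r J` with `J` proper would give `I ⊆ (I M ^ n)_r` for all `n`, where `M` is a
height-one prime containing `J`; but some power of `M` is, locally at `M`, contained in any given
nonzero principal ideal. -/
theorem isUnitCancellative (h : r.IsRNoetherian) (hmax : r.rMax = minimalNonzeroPrimes R) :
    Factorization.IsUnitCancellative r.NonzeroRIdeal := by
  intro I J hIJ
  rw [isUnit_iff]
  by_contra hJ
  obtain ⟨M, hM, hJM⟩ := h.exists_le_mem_rMax J.2.2 J.2.1 hJ
  have hMX := hM
  rw [hmax] at hMX
  have hMp := hMX.1.1
  have h1 : I.1 ≤ r.cl ((I.1 * M : Ideal R) : Set R) := by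
    have h2 := congrArg Subtype.val hIJ
    rw [coe_mul] at h2
    exact h2.le.trans (cl_mono (Ideal.mul_mono_right hJM))
  have hpow : ∀ n : ℕ, I.1 ≤ r.cl ((I.1 * M ^ n : Ideal R) : Set R) := fun n => by
    induction n with
    | zero => simpa using r.le_cl I.1
    | succ n ih =>
      refine h1.trans ?_
      have h2 : I.1 * M ^ (n + 1) = M * (I.1 * M ^ n) := by ring
      rw [h2, ← r.cl_mul_cl M, mul_comm I.1 M]
      exact cl_mono (Ideal.mul_mono_right ih)
  obtain ⟨b, hbI, hb⟩ := Submodule.exists_mem_ne_zero_of_ne_bot I.2.1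
  obtain ⟨m, hmM, hm⟩ := Submodule.exists_mem_ne_zero_of_ne_bot hMX.1.2
  obtain ⟨s, hs, n, hn⟩ := h.exists_span_singleton_mul_pow_le (isRIdeal_span_singleton (b * m))
    (Ideal.mem_minimalPrimes_span_singleton hMX (mul_ne_zero hb hm) (M.mul_mem_left b hmM))
  have h2 : Ideal.span {s} * I.1 ≤ Ideal.span {b * m} := by
    refine (Ideal.mul_mono_right (hpow n)).trans
      ((isRIdeal_span_singleton _).mul_cl_le (le_trans ?_ hn))
    exact Ideal.mul_mono_right Ideal.mul_le_right
  obtain ⟨y, hy⟩ := Ideal.mem_span_singleton'.1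
    (h2 (Ideal.mul_mem_mul (Ideal.mem_span_singleton_self s) hbI))
  have h3 : y * m = s := mul_right_cancel₀ hb (by rw [← hy]; ring)
  exact hs (h3 ▸ M.mul_mem_left y hmM)

theorem isAtomic (h : r.IsRNoetherian)
    (hcanc : Factorization.IsUnitCancellative r.NonzeroRIdeal) :
    Factorization.IsAtomic r.NonzeroRIdeal := by
  by_contra hat
  simp only [Factorization.IsAtomic, not_forall] at hat
  obtain ⟨I, hI, hI'⟩ := hat
  obtain ⟨J, -, ⟨J, ⟨hJu, hJ⟩, rfl⟩, hmax⟩ := h.exists_maximal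
    (p := fun A => ∃ B : r.NonzeroRIdeal,
      (¬ IsUnit B ∧ ¬ (Factorization.factorizations B).Nonempty) ∧ B.1 = A)
    (by rintro _ ⟨B, -, rfl⟩; exact B.2.2) ⟨I, ⟨hI, hI'⟩, rfl⟩
  have step : ∀ A B : r.NonzeroRIdeal, ¬ IsUnit A → ¬ IsUnit B → J = A * B →
      (Factorization.factorizations A).Nonempty := fun A B hA hB hAB => by
    by_contra hA'
    have h1 : J.1 ≤ A.1 := hAB ▸ coe_mul_le_left A B
    have h2 : J = A := Subtype.ext (le_antisymm h1 (hmax ⟨A, ⟨hA, hA'⟩, rfl⟩ h1))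
    exact hB (hcanc A B (h2 ▸ hAB))
  apply hJ
  by_cases hirr : Irreducible J
  · exact ⟨{J}, by simpa using hirr, by simp⟩
  · simp only [irreducible_iff, hJu, not_false_eq_true, true_and, not_forall, not_or] at hirr
    obtain ⟨A, B, hAB, hA, hB⟩ := hirr
    obtain ⟨zA, hzA, hzA'⟩ := step A B hA hB hAB
    obtain ⟨zB, hzB, hzB'⟩ := step B A hB hA (hAB.trans (mul_comm A B))
    refine ⟨zA + zB, fun u hu => ?_, by rw [Multiset.prod_add, hzA', hzB', hAB]⟩
    exact (Multiset.mem_add.1 hu).elim (hzA u) (hzB u)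

/-- An `r`-invertible `r`-ideal `Q` divides every `r`-ideal that it contains. -/
theorem dvd_of_le_of_mul_eq_principal {Q J : r.NonzeroRIdeal} {a : R} (ha : a ≠ 0)
    (hQJ : Q * J = principal r a ha) {A : r.NonzeroRIdeal} (hA : A.1 ≤ Q.1) : Q ∣ A := by
  have h1 : (A * J).1 ≤ Ideal.span {a} := by
    have h2 : (Q * J).1 = Ideal.span {a} := congrArg Subtype.val hQJ
    rw [coe_mul] at h2 ⊢
    rw [← h2]
    exact cl_mono (Ideal.mul_mono_left hA)
  obtain ⟨C, hC, hAC⟩ := IsRIdeal.exists_eq_span_singleton_mul (A * J).2.2 ha h1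
  have hC0 : C ≠ ⊥ := fun h0 => (A * J).2.1 (by rw [hAC, h0, Ideal.mul_bot])
  let C' : r.NonzeroRIdeal := ⟨C, hC0, hC⟩
  have h2 : A * J = principal r a ha * C' :=
    Subtype.ext (hAC.trans (coe_principal_mul ha C').symm)
  refine ⟨C', principal_mul_left_injective ha ?_⟩
  change principal r a ha * A = principal r a ha * (Q * C')
  rw [mul_left_comm, ← h2, ← hQJ, mul_right_comm, mul_assoc]

theorem mul_left_cancel_of_mul_eq_principal {Q J : r.NonzeroRIdeal} {a : R} (ha : a ≠ 0)
    (hQJ : Q * J = principal r a ha) {A B : r.NonzeroRIdeal} (hAB : Q * A = Q * B) : A = B := by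
  apply principal_mul_left_injective (r := r) ha
  change principal r a ha * A = principal r a ha * B
  rw [← hQJ, mul_right_comm, hAB, mul_right_comm]

/-- Atoms whose radical does not contain the conductor are `r`-invertible height-one primes, hence
cancellative prime elements of the monoid of nonzero `r`-ideals. -/
theorem dvd_or_dvd_and_cancel_of_irreducible (h : r.IsRNoetherian)
    (hmax : r.rMax = minimalNonzeroPrimes R) {I : r.NonzeroRIdeal} (hI : Irreducible I)
    (hc : ¬ completeConductor R ≤ I.1.radical) :
    (∀ A B : r.NonzeroRIdeal, I ∣ A * B → I ∣ A ∨ I ∣ B) ∧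
      ∀ A B : r.NonzeroRIdeal, I * A = I * B → A = B := by
  obtain ⟨Q, hQ, hcQ⟩ : ∃ Q ∈ I.1.minimalPrimes, ¬ completeConductor R ≤ Q := by
    rw [← Ideal.sInf_minimalPrimes, le_sInf_iff] at hc
    push Not at hc
    exact hc
  have hQp := hQ.1.1
  have hQr := h.isRIdeal_of_mem_minimalPrimes I.2.2 hQ
  have hQ0 : Q ≠ ⊥ := fun h0 => I.2.1 (le_bot_iff.1 (h0 ▸ hQ.1.2))
  have hQmax : Q ∈ r.rMax := by
    obtain ⟨M, hM, hQM⟩ := h.exists_le_mem_rMax hQr hQ0 hQp.ne_top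
    have hMX := hM
    rw [hmax] at hMX
    rwa [le_antisymm hQM (hMX.2 ⟨hQp, hQ0⟩ hQM)]
  obtain ⟨a, ha, J, hJ, hJ0, hQJ⟩ := h.exists_cl_mul_eq_span_singleton (hmax ▸ hQmax) hQmax hcQ
  obtain ⟨Q', rfl⟩ : ∃ Q' : r.NonzeroRIdeal, Q'.1 = Q := ⟨⟨Q, hQ0, hQr⟩, rfl⟩
  obtain ⟨J', rfl⟩ : ∃ J' : r.NonzeroRIdeal, J'.1 = J := ⟨⟨J, hJ0, hJ⟩, rfl⟩
  have hQJ' : Q' * J' = principal r a ha := Subtype.ext hQJ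
  obtain ⟨C, hC⟩ := dvd_of_le_of_mul_eq_principal ha hQJ' hQ.1.2
  have hQu : ¬ IsUnit Q' := fun hu => hQp.ne_top (isUnit_iff.1 hu)
  have hIQ : I = Q' := by
    rw [hC, isUnit_iff_eq_one.1 ((hI.isUnit_or_isUnit hC).resolve_left hQu), mul_one]
  rw [hIQ]
  refine ⟨fun A B hAB => ?_, fun A B hAB => mul_left_cancel_of_mul_eq_principal ha hQJ' hAB⟩
  obtain ⟨D, hD⟩ := hAB
  have h1 : A.1 * B.1 ≤ Q'.1 :=
    (r.le_cl _).trans ((congrArg Subtype.val hD).le.trans (coe_mul_le_left Q' D))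
  exact (hQp.mul_le.1 h1).imp (dvd_of_le_of_mul_eq_principal ha hQJ')
    (dvd_of_le_of_mul_eq_principal ha hQJ')

end NonzeroRIdeal

end IdealSystem

/-! ### Finiteness lemmas for multisets -/

namespace Multiset

theorem isPWO_setOf_forall_mem {α : Type*} {E : Set α} (hE : E.Finite) :
    {z : Multiset α | ∀ u ∈ z, u ∈ E}.IsPWO := by
  classical
  have := hE.to_subtype
  have h1 : (Set.univ : Set (E →₀ ℕ)).IsPWO := Set.isPWO_of_wellQuasiOrderedLE _
  have h2 := h1.image_of_monotone (f := fun x => (Finsupp.orderIsoMultiset x).map Subtype.val)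
    fun x y hxy => Multiset.map_le_map (Finsupp.orderIsoMultiset.monotone hxy)
  refine h2.mono fun z hz => ?_
  lift z to Multiset E using hz
  exact ⟨Finsupp.orderIsoMultiset.symm z, trivial, by simp⟩

/-- A translation-invariant well-order on multisets, obtained from a well-order on the underlying
type by a lexicographic comparison of multiplicities. -/
theorem exists_wellOrder_add_right (α : Type*) : ∃ s : Multiset α → Multiset α → Prop,
    WellFounded s ∧ (∀ x y, s x y ∨ x = y ∨ s y x) ∧ ∀ x y w, s (x + w) (y + w) ↔ s x y := by
  classical
  obtain ⟨_, hwf⟩ : ∃ _ : LinearOrder α, WellFoundedGT α := by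
    obtain ⟨o, ho⟩ := exists_wellFoundedLT α
    exact ⟨inferInstanceAs (LinearOrder αᵒᵈ), inferInstanceAs (WellFoundedGT αᵒᵈ)⟩
  let f : Multiset α → Lex (α →₀ ℕ) := fun x => toLex (Multiset.toFinsupp x)
  have hf : Function.Injective f := fun x y hxy => Multiset.toFinsupp.injective hxy
  have hadd : ∀ x w, f (x + w) = f x + f w := fun x w =>
    congrArg toLex (Multiset.toFinsupp.map_add x w)
  refine ⟨fun x y => f x < f y, InvImage.wf f wellFounded_lt, fun x y => ?_, fun x y w => ?_⟩
  · rw [← hf.eq_iff]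
    exact lt_trichotomy (f x) (f y)
  · change f (x + w) < f (y + w) ↔ f x < f y
    rw [hadd, hadd, add_lt_add_iff_right]

end Multiset

theorem Set.IsPWO.exists_finite_forall_le {α : Type*} [PartialOrder α] [WellFoundedLT α] {A : Set α}
    (hA : A.IsPWO) : ∃ F ⊆ A, F.Finite ∧ ∀ z ∈ A, ∃ m ∈ F, m ≤ z := by
  refine ⟨{m | Minimal (· ∈ A) m}, fun m hm => hm.1,
    (setOfPred_minimal_antichain _).finite_of_partiallyWellOrderedOn
      (hA.mono fun m hm => hm.1), fun z hz => ?_⟩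
  obtain ⟨m, hmz, hm⟩ := exists_minimal_le_of_wellFoundedLT (· ∈ A) z hz
  exact ⟨m, hm, hmz⟩

/-! ### Monoids in which all but finitely many atoms are prime -/

namespace Factorization

variable {H : Type*} [CommMonoid H]

/-- `E` is a finite set such that every atom outside `E` is a cancellative prime element. -/
structure PrimeOutside (E : Set H) : Prop where
  finite : E.Finite
  dvd_or_dvd : ∀ p, Irreducible p → p ∉ E → ∀ a b, p ∣ a * b → p ∣ a ∨ p ∣ b
  cancel : ∀ p, Irreducible p → p ∉ E → ∀ a b, p * a = p * b → a = b

/-- The multisets of atoms that all lie in `E`. -/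
def atomMultisets (E : Set H) : Set (Multiset H) :=
  {z | ∀ u ∈ z, u ∈ E ∧ Irreducible u}

variable {E : Set H}

theorem isPWO_atomMultisets (hE : E.Finite) : (atomMultisets E).IsPWO :=
  (Multiset.isPWO_setOf_forall_mem hE).mono fun _ hz u hu => (hz u hu).1

theorem mem_atomMultisets_of_le {x y : Multiset H} (hy : y ∈ atomMultisets E) (h : x ≤ y) :
    x ∈ atomMultisets E := fun u hu => hy u (Multiset.mem_of_le h hu)

theorem PrimeOutside.mem_of_dvd_prod [Subsingleton Hˣ] (hE : PrimeOutside E) {p : H}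
    (hp : Irreducible p) (hpE : p ∉ E) {z : Multiset H} (hz : ∀ u ∈ z, Irreducible u)
    (h : p ∣ z.prod) : p ∈ z := by
  induction z using Multiset.induction_on with
  | empty => exact absurd (isUnit_of_dvd_one (by simpa using h)) hp.not_isUnit
  | cons q z ih =>
    rw [Multiset.prod_cons] at h
    rcases hE.dvd_or_dvd p hp hpE _ _ h with h | h
    · obtain ⟨c, rfl⟩ := h
      have hq := hz (p * c) (Multiset.mem_cons_self _ _)
      have hc : c = 1 :=
        isUnit_iff_eq_one.1 ((hq.isUnit_or_isUnit rfl).resolve_left hp.not_isUnit)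
      simp [hc]
    · exact Multiset.mem_cons_of_mem (ih (fun u hu => hz u (Multiset.mem_cons_of_mem hu)) h)

/-- Two factorizations of the same element have the same atoms outside `E`, and what remains are
two factorizations of the same element into atoms from `E`. -/
theorem PrimeOutside.exists_eq_add [Subsingleton Hˣ] (hE : PrimeOutside E) {z y : Multiset H}
    (hz : ∀ u ∈ z, Irreducible u) (hy : ∀ u ∈ y, Irreducible u) (h : z.prod = y.prod) :
    ∃ p z' y', z = p + z' ∧ y = p + y' ∧ z' ∈ atomMultisets E ∧ y' ∈ atomMultisets E ∧
      z'.prod = y'.prod := by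
  induction hn : Multiset.card z using Nat.strong_induction_on generalizing z y with
  | _ n ih =>
    by_cases hzy : ∃ q, (q ∈ z ∨ q ∈ y) ∧ q ∉ E
    · obtain ⟨q, hq, hqE⟩ := hzy
      have hmem : q ∈ z ∧ q ∈ y := by
        rcases hq with hq | hq
        · exact ⟨hq, hE.mem_of_dvd_prod (hz q hq) hqE hy (h ▸ Multiset.dvd_prod hq)⟩
        · exact ⟨hE.mem_of_dvd_prod (hy q hq) hqE hz (h ▸ Multiset.dvd_prod hq), hq⟩
      obtain ⟨z₁, rfl⟩ := Multiset.exists_cons_of_mem hmem.1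
      obtain ⟨y₁, rfl⟩ := Multiset.exists_cons_of_mem hmem.2
      rw [Multiset.prod_cons, Multiset.prod_cons] at h
      rw [Multiset.card_cons] at hn
      obtain ⟨p, z', y', rfl, rfl, hz', hy', hprod⟩ := ih _ (by omega)
        (fun u hu => hz u (Multiset.mem_cons_of_mem hu))
        (fun u hu => hy u (Multiset.mem_cons_of_mem hu))
        (hE.cancel q (hz q hmem.1) hqE _ _ h) rfl
      exact ⟨q ::ₘ p, z', y', by simp, by simp, hz', hy', hprod⟩
    · push Not at hzy
      exact ⟨0, z, y, by simp, by simp, fun u hu => ⟨hzy u (Or.inl hu), hz u hu⟩,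
        fun u hu => ⟨hzy u (Or.inr hu), hy u hu⟩, h⟩

theorem dist_add_le {α : Type*} (w m m' : Multiset α) :
    dist (w + m) (w + m') ≤ max (Multiset.card m) (Multiset.card m') := by
  classical
  unfold dist
  have h1 : ∀ x y : Multiset α, Multiset.card ((w + x) - (w + y)) ≤ Multiset.card x :=
    fun x y => Multiset.card_le_card <| by
      rw [add_tsub_add_eq_tsub_left]
      exact tsub_le_self
  exact max_le_max (h1 m m') (h1 m' m)

/-- If a factorization `z` can be changed into one that is `s`-related to `z`, for a
translation-invariant relation `s`, then this can be done by a change of bounded size. Indeed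
the pieces of `z` made of atoms in `E` that can be so changed form an upward closed set, which by
Dickson's lemma has finitely many minimal elements. -/
theorem PrimeOutside.exists_bounded_move [Subsingleton Hˣ] (hE : PrimeOutside E)
    {s : Multiset H → Multiset H → Prop} (hs : ∀ x y w, s (x + w) (y + w) ↔ s x y) :
    ∃ N : ℕ, ∀ a : H, ∀ z ∈ factorizations a, (∃ y ∈ factorizations a, s z y) →
      ∃ y ∈ factorizations a, s z y ∧ dist z y ≤ N := by
  have hA : {z ∈ atomMultisets E | ∃ y ∈ atomMultisets E, z.prod = y.prod ∧ s z y}.IsPWO :=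
    (isPWO_atomMultisets hE.finite).mono fun _ hz => hz.1
  obtain ⟨F, hFA, hF, hmin⟩ := hA.exists_finite_forall_le
  have hF' : ∀ m ∈ F, ∃ y ∈ atomMultisets E, m.prod = y.prod ∧ s m y := fun m hm => (hFA hm).2
  choose! g hg using hF'
  obtain ⟨N, hN⟩ := (hF.image fun m => max (Multiset.card m) (Multiset.card (g m))).bddAbove
  refine ⟨N, fun a z hz ⟨y, hy, hzy⟩ => ?_⟩
  obtain ⟨p, z', y', rfl, rfl, hz', hy', hprod⟩ := hE.exists_eq_add hz.1 hy.1 (hz.2.trans hy.2.symm)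
  rw [add_comm p, add_comm p, hs] at hzy
  obtain ⟨m, hm, hmz⟩ := hmin z' ⟨hz', y', hy', hprod, hzy⟩
  obtain ⟨w, rfl⟩ := Multiset.le_iff_exists_add.1 hmz
  obtain ⟨hgE, hgp, hgs⟩ := hg m hm
  have hw : p + (m + w) = p + w + m := by abel
  rw [hw] at hz ⊢
  refine ⟨p + w + g m, ⟨fun u hu => ?_, ?_⟩, ?_, ?_⟩
  · rcases Multiset.mem_add.1 hu with hu | hu
    · exact hz.1 u (Multiset.mem_add.2 (Or.inl hu))
    · exact (hgE u hu).2
  · rw [Multiset.prod_add, ← hgp, ← Multiset.prod_add, hz.2]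
  · rwa [add_comm, add_comm _ (g m), hs]
  · exact (dist_add_le _ _ _).trans (hN ⟨m, hm, rfl⟩)

/-! ### Distances, catenary degrees and successive distances -/

theorem adjacent_iff {L : Set ℕ} {k l : ℕ} :
    Adjacent L k l ↔ k ≠ l ∧ k ∈ L ∧ l ∈ L ∧ ∀ m ∈ L, min k l ≤ m → m ≤ max k l → m = k ∨ m = l := by
  refine and_congr_right fun _ => ⟨fun h => ?_, fun ⟨hk, hl, h⟩ => ?_⟩
  · have hk : k ∈ L ∩ Set.Icc (min k l) (max k l) := by rw [h]; simp
    have hl : l ∈ L ∩ Set.Icc (min k l) (max k l) := by rw [h]; simp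
    refine ⟨hk.1, hl.1, fun m hm h1 h2 => ?_⟩
    have : m ∈ L ∩ Set.Icc (min k l) (max k l) := ⟨hm, h1, h2⟩
    rw [h] at this
    simpa using this
  · ext m
    constructor
    · rintro ⟨hm, h1, h2⟩
      simpa using h m hm h1 h2
    · rintro (rfl | rfl)
      · exact ⟨hk, by simp⟩
      · exact ⟨hl, by simp⟩

theorem card_le_add_dist {α : Type*} (z y : Multiset α) :
    Multiset.card y ≤ Multiset.card z + dist z y ∧
      Multiset.card z ≤ Multiset.card y + dist z y := by
  classical
  unfold dist
  have h1 := Multiset.card_le_card (le_add_tsub (a := z) (b := y))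
  have h2 := Multiset.card_le_card (le_add_tsub (a := y) (b := z))
  rw [Multiset.card_add] at h1 h2
  omega

theorem PrimeOutside.exists_distance_le [Subsingleton Hˣ] (hE : PrimeOutside E) :
    ∃ N : ℕ, ∀ (a : H) (k l : ℕ), Adjacent (lengths a) k l → k < l → l ≤ k + N := by
  obtain ⟨N, hN⟩ := hE.exists_bounded_move
    (s := fun x y => Multiset.card x < Multiset.card y) (by simp)
  refine ⟨N, fun a k l hkl hlt => ?_⟩
  obtain ⟨-, ⟨z, hz, rfl⟩, ⟨y, hy, rfl⟩, h⟩ := adjacent_iff.1 hkl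
  obtain ⟨x, hx, hzx, hd⟩ := hN a z hz ⟨y, hy, hlt⟩
  have h1 := (card_le_add_dist z x).1
  by_contra! hcon
  rcases h _ ⟨x, hx, rfl⟩ (by omega) (by omega) with h2 | h2 <;> omega

/-- The bound on successive distances, in elementary form. -/
theorem PrimeOutside.exists_successive_le [Subsingleton Hˣ] (hE : PrimeOutside E) :
    ∃ N : ℕ, ∀ (a : H), ∀ z ∈ factorizations a, ∀ k, Adjacent (lengths a) k (Multiset.card z) →
      ∃ y ∈ factorizations a, Multiset.card y = k ∧ dist z y ≤ N := by
  obtain ⟨D, hD⟩ := hE.exists_distance_le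
  choose f hf using fun d : ℕ => hE.exists_bounded_move
    (s := fun x y => Multiset.card y = Multiset.card x + d) (by intro x y w; simp; omega)
  choose g hg using fun d : ℕ => hE.exists_bounded_move
    (s := fun x y => Multiset.card x = Multiset.card y + d) (by intro x y w; simp; omega)
  refine ⟨(Finset.range (D + 1)).sup fun d => max (f d) (g d), fun a z hz k hk => ?_⟩
  obtain ⟨hne, ⟨y, hy, rfl⟩, hzL, h⟩ := adjacent_iff.1 hk
  have hbd : ∀ d ≤ D, max (f d) (g d) ≤ (Finset.range (D + 1)).sup fun d => max (f d) (g d) :=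
    fun d hd => Finset.le_sup (f := fun d => max (f d) (g d)) (Finset.mem_range.2 (by omega))
  rcases lt_or_gt_of_ne hne with hlt | hlt
  · obtain ⟨d, hd⟩ := Nat.exists_eq_add_of_lt hlt
    obtain ⟨x, hx, hzx, hxd⟩ := hg (d + 1) a z hz ⟨y, hy, by omega⟩
    have h1 := hD a _ _ hk hlt
    exact ⟨x, hx, by omega, hxd.trans ((le_max_right _ _).trans (hbd _ (by omega)))⟩
  · obtain ⟨d, hd⟩ := Nat.exists_eq_add_of_lt hlt
    obtain ⟨x, hx, hzx, hxd⟩ := hf (d + 1) a z hz ⟨y, hy, by omega⟩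
    have hk' : Adjacent (lengths a) (Multiset.card z) (Multiset.card y) := by
      rw [adjacent_iff]
      refine ⟨hne.symm, hzL, ⟨y, hy, rfl⟩, fun m hm h1 h2 => (h m hm ?_ ?_).symm⟩ <;> omega
    have h1 := hD a _ _ hk' hlt
    exact ⟨x, hx, by omega, hxd.trans ((le_max_left _ _).trans (hbd _ (by omega)))⟩

theorem dist_comm {α : Type*} (z y : Multiset α) : dist z y = dist y z := max_comm _ _

/-- One step of a nondecreasing chain of factorizations of `a` with distances bounded by `N`. -/
def AscStep (a : H) (N : ℕ) (z y : Multiset H) : Prop :=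
  y ∈ factorizations a ∧ dist z y ≤ N ∧ Multiset.card z ≤ Multiset.card y

theorem exists_chain_of_reflTransGen {a : H} {N : ℕ} {z y : Multiset H} (hz : z ∈ factorizations a)
    (h : Relation.ReflTransGen (AscStep a N) z y) :
    ∃ (k : ℕ) (f : ℕ → Multiset H), f 0 = z ∧ f k = y ∧ (∀ i ≤ k, f i ∈ factorizations a) ∧
      (∀ i < k, dist (f i) (f (i + 1)) ≤ N) ∧
      ∀ i < k, Multiset.card (f i) ≤ Multiset.card (f (i + 1)) := by
  induction h with
  | refl => exact ⟨0, fun _ => z, rfl, rfl, fun _ _ => hz, by simp, by simp⟩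
  | @tail b c _ hbc ih =>
    obtain ⟨k, f, h0, hk, hf, hd, hm⟩ := ih
    refine ⟨k + 1, fun i => if i ≤ k then f i else c, by simpa using h0, by simp, fun i hi => ?_,
      fun i hi => ?_, fun i hi => ?_⟩
    · dsimp only
      split_ifs with h
      · exact hf i h
      · exact hbc.1
    all_goals
      dsimp only
      rcases Nat.lt_succ_iff_lt_or_eq.1 hi with h | rfl
      · rw [if_pos (by omega), if_pos (by omega)]
        first | exact hd i h | exact hm i h
      · rw [if_pos le_rfl, if_neg (by omega), hk]
        first | exact hbc.2.1 | exact hbc.2.2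

theorem HasMonotoneChain.of_reflTransGen {a : H} {N : ℕ} {z y : Multiset H}
    (hz : z ∈ factorizations a) (h : Relation.ReflTransGen (AscStep a N) z y) :
    HasMonotoneChain a N z y ∧ HasMonotoneChain a N y z := by
  obtain ⟨k, f, h0, hk, hf, hd, hm⟩ := exists_chain_of_reflTransGen hz h
  refine ⟨⟨k, f, h0, hk, hf, fun i hi => by exact_mod_cast hd i hi, Or.inl hm⟩,
    k, fun i => f (k - i), by simpa using hk, by simpa using h0, fun i _ => hf _ (by omega),
    fun i hi => ?_, Or.inr fun i hi => ?_⟩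
  · have h1 := hd (k - (i + 1)) (by omega)
    rw [show k - (i + 1) + 1 = k - i by omega, dist_comm] at h1
    exact_mod_cast h1
  · have h1 := hm (k - (i + 1)) (by omega)
    rwa [show k - (i + 1) + 1 = k - i by omega] at h1

/-- Factorizations of equal length are linked by bounded steps through factorizations of that same
length: both descend to the least factorization of this length, for a translation-invariant
well-order on multisets. -/
theorem PrimeOutside.exists_equal_length_chain [Subsingleton Hˣ] (hE : PrimeOutside E) :
    ∃ N : ℕ, ∀ a : H, ∀ z ∈ factorizations a, ∀ y ∈ factorizations a,
      Multiset.card z = Multiset.card y → Relation.ReflTransGen (AscStep a N) z y := by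
  obtain ⟨s, hwf, htri, hadd⟩ := Multiset.exists_wellOrder_add_right H
  obtain ⟨N, hN⟩ := hE.exists_bounded_move
    (s := fun x y => Multiset.card x = Multiset.card y ∧ s y x) (by simp [hadd])
  refine ⟨N, fun a z hz y hy hzy => ?_⟩
  obtain ⟨x, ⟨hx, hxz⟩, hmin⟩ := hwf.has_min
    {x | x ∈ factorizations a ∧ Multiset.card x = Multiset.card z} ⟨z, hz, rfl⟩
  have key : ∀ w ∈ factorizations a, Multiset.card w = Multiset.card z →
      Relation.ReflTransGen (AscStep a N) w x ∧ Relation.ReflTransGen (AscStep a N) x w := by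
    intro w
    induction w using hwf.induction with
    | _ w ih =>
      intro hw hwz
      rcases htri w x with h | rfl | h
      · exact absurd h (hmin w ⟨hw, hwz⟩)
      · exact ⟨.refl, .refl⟩
      · obtain ⟨v, hv, ⟨hcard, hsv⟩, hd⟩ := hN a w hw ⟨x, hx, by omega, h⟩
        obtain ⟨h1, h2⟩ := ih v hsv hv (by omega)
        exact ⟨h1.head ⟨hv, hd, by omega⟩, h2.tail ⟨hw, by rwa [dist_comm], by omega⟩⟩
  exact (key z hz rfl).1.trans (key y hy hzy.symm).2

theorem PrimeOutside.exists_monotone_chain [Subsingleton Hˣ] (hE : PrimeOutside E) :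
    ∃ N : ℕ, ∀ a : H, ∀ z ∈ factorizations a, ∀ y ∈ factorizations a, HasMonotoneChain a N z y := by
  obtain ⟨N₁, hN₁⟩ := hE.exists_equal_length_chain
  obtain ⟨N₂, hN₂⟩ := hE.exists_successive_le
  have hasc : ∀ a : H, ∀ z ∈ factorizations a, ∀ y ∈ factorizations a,
      Multiset.card z ≤ Multiset.card y →
        Relation.ReflTransGen (AscStep a (max N₁ N₂)) z y := by
    intro a z hz y hy hzy
    induction hn : Multiset.card y - Multiset.card z using Nat.strong_induction_on
      generalizing z with
    | _ n ih =>
      rcases hzy.eq_or_lt with heq | hlt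
      · exact Relation.ReflTransGen.mono
          (fun _ _ h => ⟨h.1, h.2.1.trans (le_max_left _ _), h.2.2⟩) _ _ (hN₁ a z hz y hy heq)
      · classical
        have hex : ∃ k, k ∈ lengths a ∧ Multiset.card z < k := ⟨_, ⟨y, hy, rfl⟩, hlt⟩
        obtain ⟨hk1, hk2⟩ := Nat.find_spec hex
        have hky := Nat.find_min' hex ⟨⟨y, hy, rfl⟩, hlt⟩
        have hadj : Adjacent (lengths a) (Nat.find hex) (Multiset.card z) := by
          rw [adjacent_iff]
          refine ⟨hk2.ne', hk1, ⟨z, hz, rfl⟩, fun m hm h1 h2 => ?_⟩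
          by_contra! hcon
          exact Nat.find_min hex (m := m) (by omega) ⟨hm, by omega⟩
        obtain ⟨x, hx, hxk, hd⟩ := hN₂ a z hz _ hadj
        exact (ih _ (by omega) x hx (by omega) rfl).head
          ⟨hx, hd.trans (le_max_right _ _), by omega⟩
  refine ⟨max N₁ N₂, fun a z hz y hy => ?_⟩
  rcases le_total (Multiset.card z) (Multiset.card y) with h | h
  · exact (HasMonotoneChain.of_reflTransGen hz (hasc a z hz y hy h)).1
  · exact (HasMonotoneChain.of_reflTransGen hy (hasc a y hy z hz h)).2

theorem PrimeOutside.monotoneCatenaryDegree_lt_top [Subsingleton Hˣ] (hE : PrimeOutside E) :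
    monotoneCatenaryDegree H < ⊤ := by
  obtain ⟨N, hN⟩ := hE.exists_monotone_chain
  refine (iSup_le fun a => sInf_le fun z hz y hy => ?_).trans_lt (ENat.natCast_lt_top N)
  exact hN a z hz y hy

theorem PrimeOutside.catenaryDegree_lt_top [Subsingleton Hˣ] (hE : PrimeOutside E) :
    catenaryDegree H < ⊤ := by
  obtain ⟨N, hN⟩ := hE.exists_monotone_chain
  refine (iSup_le fun a => sInf_le fun z hz y hy => ?_).trans_lt (ENat.natCast_lt_top N)
  obtain ⟨k, f, h0, hk, hf, hd, -⟩ := hN a z hz y hy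
  exact ⟨k, f, h0, hk, hf, hd⟩

theorem PrimeOutside.successiveDistance_lt_top [Subsingleton Hˣ] (hE : PrimeOutside E) :
    successiveDistance H < ⊤ := by
  obtain ⟨N, hN⟩ := hE.exists_successive_le
  refine (iSup_le fun a => iSup₂_le fun z hz => sInf_le fun k hk => ?_).trans_lt
    (ENat.natCast_lt_top N)
  obtain ⟨y, hy, hyk, hd⟩ := hN a z hz k hk
  exact ⟨y, hy, hyk, by exact_mod_cast hd⟩

theorem PrimeOutside.finite_distances [Subsingleton Hˣ] (hE : PrimeOutside E) :
    (distances H).Finite := by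
  obtain ⟨N, hN⟩ := hE.exists_successive_le
  refine (Set.finite_le_nat N).subset ?_
  rintro _ ⟨a, k, l, hkl, rfl⟩
  obtain ⟨-, -, ⟨z, hz, rfl⟩, -⟩ := adjacent_iff.1 hkl
  obtain ⟨y, -, hyk, hd⟩ := hN a z hz k hkl
  have := card_le_add_dist z y
  simp only [Set.mem_ofPred_eq]
  omega

end Factorization

/-! ### Symmetric relations between lengths -/

namespace Factorization

/-- A set of naturals squeezed between the elements `k + d t` with `t` in
`[-(k₁ e) / h, k₁ e / g]` and those with `t` in `[-(k e) / h, k e / g]`, where `k = k₁ + m`, is an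
arithmetical progression with difference `d` up to end pieces whose size depends on `d`, `m`, `e`
only. -/
theorem exists_progression_of_bounds {U : Set ℕ} {k k₁ d e g h m : ℕ} (hk : k = k₁ + m)
    (hd : 0 < d) (hg : 0 < g) (hh : 0 < h)
    (hsub : ∀ l ∈ U, ∃ t : ℤ, (l : ℤ) = k + d * t ∧ -(k * e : ℤ) ≤ t * h ∧ t * g ≤ (k * e : ℤ))
    (hsup : ∀ t : ℤ, -(k₁ * e : ℤ) ≤ t * h → t * g ≤ (k₁ * e : ℤ) →
      ∃ l ∈ U, (l : ℤ) = k + d * t) :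
    ∃ (y : ℤ) (L' L L'' : Set ℤ),
      (fun n : ℕ => (n : ℤ)) '' U = (fun x => y + x) '' (L' ∪ L ∪ L'') ∧
      (∀ x ∈ L' ∪ L ∪ L'', (d : ℤ) ∣ x) ∧
      L' ⊆ Set.Icc (-((d * (m * e + 1) : ℕ) : ℤ)) (-1) ∧
      ∃ n : ℕ, L = {x | ∃ i : ℕ, i ≤ n ∧ x = (d : ℤ) * i} ∧
        L'' ⊆ Set.Icc ((d : ℤ) * n + 1) ((d : ℤ) * n + (d * (m * e + 1) : ℕ)) := by
  obtain ⟨i, hi₁, hi₂⟩ : ∃ i : ℕ, i * h ≤ k₁ * e ∧ k₁ * e < (i + 1) * h :=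
    ⟨k₁ * e / h, Nat.div_mul_le_self _ _, Nat.lt_mul_of_div_lt (Nat.lt_succ_self _) hh⟩
  obtain ⟨j, hj₁, hj₂⟩ : ∃ j : ℕ, j * g ≤ k₁ * e ∧ k₁ * e < (j + 1) * g :=
    ⟨k₁ * e / g, Nat.div_mul_le_self _ _, Nat.lt_mul_of_div_lt (Nat.lt_succ_self _) hg⟩
  zify at hi₁ hi₂ hj₁ hj₂
  have hd' : (0 : ℤ) < d := by exact_mod_cast hd
  have hg' : (1 : ℤ) ≤ g := by exact_mod_cast hg
  have hh' : (1 : ℤ) ≤ h := by exact_mod_cast hh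
  have hme : (0 : ℤ) ≤ m * e := by positivity
  have hke : (k * e : ℤ) = k₁ * e + m * e := by subst hk; push_cast; ring
  -- In terms of `t`, the end pieces have length at most `m e`.
  have key : ∀ l ∈ U, ∃ t : ℤ, (l : ℤ) = k + d * t ∧ -(i + m * e + 1 : ℤ) ≤ t ∧
      t ≤ j + m * e + 1 := fun l hl => by
    obtain ⟨t, ht, h1, h2⟩ := hsub l hl
    refine ⟨t, ht, ?_, ?_⟩
    · by_contra! hcon
      have h3 : (-(t + i + 1)) * 1 ≤ (-(t + i + 1)) * (h : ℤ) :=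
        mul_le_mul_of_nonneg_left hh' (by linarith)
      linarith
    · by_contra! hcon
      have h3 : (t - j - 1) * 1 ≤ (t - j - 1) * (g : ℤ) :=
        mul_le_mul_of_nonneg_left hg' (by linarith)
      linarith
  set V : Set ℤ := (fun n : ℕ => (n : ℤ)) '' U
  have hV : ∀ x : ℤ, (k - d * i : ℤ) + x ∈ V → ∃ t : ℤ, x = d * t ∧ -(m * e + 1 : ℤ) ≤ t ∧
      t ≤ i + j + m * e + 1 := by
    rintro x ⟨l, hl, hlx⟩
    obtain ⟨t, ht, h1, h2⟩ := key l hl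
    refine ⟨t + i, ?_, by linarith, by linarith⟩
    dsimp only at hlx
    linear_combination ht - hlx
  refine ⟨k - d * i, {x | (k - d * i : ℤ) + x ∈ V ∧ x < 0},
    {x | ∃ n : ℕ, n ≤ i + j ∧ x = (d : ℤ) * n},
    {x | (k - d * i : ℤ) + x ∈ V ∧ (d : ℤ) * (i + j : ℕ) < x}, ?_, ?_, ?_, i + j, rfl, ?_⟩
  · apply Set.Subset.antisymm
    · intro n hn
      refine ⟨n - (k - d * i), ?_, by simp⟩
      have hn' : (k - d * i : ℤ) + (n - (k - d * i)) ∈ V := by simpa using hn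
      generalize (n - (k - d * i) : ℤ) = x at hn'
      obtain ⟨t, rfl, -, -⟩ := hV x hn'
      by_cases h1 : t < 0
      · exact Or.inl (Or.inl ⟨hn', by nlinarith⟩)
      · push Not at h1
        by_cases h2 : t ≤ (i + j : ℕ)
        · exact Or.inl (Or.inr ⟨t.toNat, by omega, by rw [Int.toNat_of_nonneg h1]⟩)
        · push Not at h2
          exact Or.inr ⟨hn', mul_lt_mul_of_pos_left h2 hd'⟩
    · rintro _ ⟨x, (⟨hx, -⟩ | ⟨n, hn, rfl⟩) | ⟨hx, -⟩, rfl⟩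
      · exact hx
      · have hn' : (n : ℤ) ≤ i + j := by exact_mod_cast hn
        have hn0 : (0 : ℤ) ≤ n := by positivity
        obtain ⟨l, hl, hlt⟩ := hsup (n - i)
          ((by linarith : -(k₁ * e : ℤ) ≤ (-i) * h).trans
            (mul_le_mul_of_nonneg_right (by linarith) (by linarith)))
          ((mul_le_mul_of_nonneg_right (by linarith) (by linarith)).trans hj₁)
        exact ⟨l, hl, by dsimp only; rw [hlt]; ring⟩
      · exact hx
  · rintro x ((⟨hx, -⟩ | ⟨n, hn, rfl⟩) | ⟨hx, -⟩)
    · obtain ⟨t, rfl, -, -⟩ := hV x hx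
      exact dvd_mul_right _ _
    · exact dvd_mul_right _ _
    · obtain ⟨t, rfl, -, -⟩ := hV x hx
      exact dvd_mul_right _ _
  · rintro x ⟨hx, hx0⟩
    obtain ⟨t, rfl, h1, -⟩ := hV x hx
    refine ⟨?_, by omega⟩
    have := mul_le_mul_of_nonneg_left h1 hd'.le
    push_cast
    linarith
  · rintro x ⟨hx, hx0⟩
    obtain ⟨t, rfl, -, h1⟩ := hV x hx
    refine ⟨by omega, ?_⟩
    have := mul_le_mul_of_nonneg_left h1 hd'.le
    push_cast
    linarith

/-- A symmetric additive relation `W` on `ℕ`, containing the diagonal, which lies in the cone of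
slope `h / g` and contains a translate `c + q (g, h)`, `q ∈ ℕ`, of the boundary ray, contains a
diagonal translate of all points of the cone that are allowed by the congruence modulo the greatest
common divisor of the differences. -/
theorem exists_progression_of_cone {W : ℕ → ℕ → Prop} (hrefl : ∀ k, W k k)
    (hsymm : ∀ k l, W k l → W l k) (hadd : ∀ k l k' l', W k l → W k' l' → W (k + k') (l + l'))
    {g h c : ℕ} (hg : 0 < g) (hray : ∀ q : ℕ, W (c + q * g) (c + q * h))
    (hcone : ∀ k l, W k l → l * g ≤ k * h) :
    ∃ d : ℕ, 0 < d ∧ ∃ M : ℕ, ∃ k₀ : ℕ, ∀ k : ℕ, k₀ ≤ k →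
      ∃ (y : ℤ) (L' L L'' : Set ℤ),
        (fun n : ℕ => (n : ℤ)) '' {l | W k l} = (fun x => y + x) '' (L' ∪ L ∪ L'') ∧
        (∀ x ∈ L' ∪ L ∪ L'', (d : ℤ) ∣ x) ∧
        L' ⊆ Set.Icc (-(M : ℤ)) (-1) ∧
        ∃ n : ℕ, L = {x | ∃ i : ℕ, i ≤ n ∧ x = (d : ℤ) * i} ∧
          L'' ⊆ Set.Icc ((d : ℤ) * n + 1) ((d : ℤ) * n + M) := by
  let D : AddSubgroup ℤ :=
    { carrier := {x | ∃ k l : ℕ, W k l ∧ x = l - k}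
      zero_mem' := ⟨0, 0, hrefl 0, by simp⟩
      add_mem' := by
        rintro _ _ ⟨k, l, hkl, rfl⟩ ⟨k', l', hkl', rfl⟩
        exact ⟨k + k', l + l', hadd _ _ _ _ hkl hkl', by push_cast; ring⟩
      neg_mem' := by
        rintro _ ⟨k, l, hkl, rfl⟩
        exact ⟨l, k, hsymm _ _ hkl, by ring⟩ }
  obtain ⟨d, hD⟩ : ∃ d : ℕ, D = AddSubgroup.zmultiples (d : ℤ) := by
    obtain ⟨a, ha⟩ := Int.subgroup_cyclic D
    refine ⟨a.natAbs, ?_⟩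
    rw [ha, Int.zmultiples_natAbs, AddSubgroup.zmultiples_eq_closure]
  have hdvd : ∀ k l, W k l → (d : ℤ) ∣ l - k := fun k l hkl => by
    rw [← Int.mem_zmultiples_iff, ← hD]
    exact ⟨k, l, hkl, rfl⟩
  rcases Nat.eq_zero_or_pos d with rfl | hd
  · refine ⟨1, one_pos, 0, 0, fun k _ => ⟨k, ∅, {0}, ∅, ?_, by simp, by simp, 0, ?_, by simp⟩⟩
    · have : {l | W k l} = {k} := by
        ext l
        refine ⟨fun hl => ?_, fun hl => by rw [Set.mem_singleton_iff.1 hl]; exact hrefl k⟩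
        have := hdvd k l hl
        simp only [Nat.cast_zero, zero_dvd_iff] at this
        simp only [Set.mem_singleton_iff]
        omega
      simp [this]
    · ext x
      simp
  obtain ⟨k₀, l₀, hW₀, hkl₀⟩ : ∃ k l : ℕ, W k l ∧ (d : ℤ) = l - k := by
    have : (d : ℤ) ∈ D := by rw [hD]; exact AddSubgroup.mem_zmultiples _
    exact this
  obtain rfl : l₀ = k₀ + d := by omega
  have hgh : g < h := by
    by_contra! hcon
    have h1 := hcone _ _ hW₀
    nlinarith [Nat.mul_le_mul_left k₀ hcon]
  obtain ⟨e, he⟩ : ∃ e : ℕ, h = g + e * d := by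
    have h1 := hdvd _ _ (hray 1)
    rw [show ((c + 1 * h : ℕ) : ℤ) - (c + 1 * g : ℕ) = ((h - g : ℕ) : ℤ) by
      push_cast [Nat.cast_sub hgh.le]; ring] at h1
    obtain ⟨e, he⟩ := Int.natCast_dvd_natCast.1 h1
    exact ⟨e, by rw [mul_comm, ← he]; omega⟩
  have he0 : 0 < e := Nat.pos_of_ne_zero fun h0 => by simp [h0] at he; omega
  have hdiag : ∀ k l n, W k l → W (k + n) (l + n) := fun k l n hkl => hadd _ _ _ _ hkl (hrefl n)
  have hmul : ∀ s : ℕ, W (s * k₀) (s * (k₀ + d)) := fun s => by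
    induction s with
    | zero => simpa using hrefl 0
    | succ s ih => rw [Nat.succ_mul, Nat.succ_mul]; exact hadd _ _ _ _ ih hW₀
  -- With `t = q e + s`, `s < e`, the point `(k, k + d t)` is `q (g, h) + s (k₀, k₀ + d)` up to
  -- a diagonal translation; the latter is nonnegative because of `q g ≤ k` and `s ≤ e`.
  have hdeep : ∀ k t : ℕ, t * g ≤ k * e →
      W (k + (c + e * k₀)) (k + d * t + (c + e * k₀)) := fun k t ht => by
    set q := t / e
    set s := t % e
    have hts : t = q * e + s := by rw [mul_comm]; exact (Nat.div_add_mod t e).symm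
    have hs : s ≤ e := (Nat.mod_lt t he0).le
    have hqk : q * g ≤ k := by
      refine Nat.le_of_mul_le_mul_right (le_trans ?_ ht) he0
      rw [hts]
      nlinarith
    obtain ⟨a, ha⟩ := Nat.exists_eq_add_of_le hqk
    obtain ⟨b, hb⟩ := Nat.exists_eq_add_of_le (Nat.mul_le_mul_right k₀ hs)
    have h1 := hdiag _ _ (a + b) (hadd _ _ _ _ (hray q) (hmul s))
    convert h1 using 1
    · rw [ha, hb]; ring
    · rw [ha, hb, hts, he]; ring
  have hh : 0 < h := by omega
  refine ⟨d, hd, d * ((c + e * k₀) * e + 1), c + e * k₀, fun k hk => ?_⟩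
  obtain ⟨k₁, rfl⟩ := Nat.exists_eq_add_of_le' hk
  have he' : (h : ℤ) = g + e * d := by exact_mod_cast he
  have hd' : (0 : ℤ) < d := by exact_mod_cast hd
  refine exists_progression_of_bounds (k := k₁ + (c + e * k₀)) (h := h) rfl hd hg hh (fun l hl => ?_) fun t ht₁ ht₂ => ?_
  · obtain ⟨t, ht⟩ := hdvd _ _ hl
    have hl' : (l : ℤ) = (k₁ + (c + e * k₀) : ℕ) + d * t := by linear_combination ht
    have h1 := hcone _ _ hl
    have h2 := hcone _ _ (hsymm _ _ hl)
    generalize k₁ + (c + e * k₀) = k at hl' h1 h2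
    zify at h1 h2
    rw [hl', he'] at h1 h2
    refine ⟨t, hl', ?_, ?_⟩
    · refine le_of_mul_le_mul_left ?_ hd'
      rw [he']
      linarith
    · refine le_of_mul_le_mul_left ?_ hd'
      linarith
  · rcases le_or_gt 0 t with h0 | h0
    · lift t to ℕ using h0
      refine ⟨_, hdeep k₁ t (by exact_mod_cast ht₂), ?_⟩
      push_cast; ring
    · -- Below the diagonal, reflect: `(k, l)` becomes `(l, k)`, with `l = k₁ - d t ≥ 0`.
      obtain ⟨t, rfl⟩ : ∃ u : ℕ, t = -u := ⟨t.natAbs, by omega⟩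
      have h1 : t * h ≤ k₁ * e := by
        zify; linarith
      have h2 : d * t ≤ k₁ := by
        refine Nat.le_of_mul_le_mul_right (le_trans ?_ h1) he0
        rw [he]
        nlinarith [Nat.zero_le (t * g)]
      obtain ⟨l, rfl⟩ := Nat.exists_eq_add_of_le' h2
      refine ⟨_, hsymm _ _ (hdeep l t ?_), ?_⟩
      · rw [he] at h1
        nlinarith
      · push_cast; ring

/-! ### The Structure Theorem for Unions -/

variable {H : Type*} [CommMonoid H] {E : Set H}

theorem add_mem_factorizations {a b : H} {x y : Multiset H} (hx : x ∈ factorizations a)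
    (hy : y ∈ factorizations b) : x + y ∈ factorizations (a * b) :=
  ⟨fun u hu => (Multiset.mem_add.1 hu).elim (hx.1 u) (hy.1 u), by
    rw [Multiset.prod_add, hx.2, hy.2]⟩

theorem IsUnitCancellative.eq_zero_of_mul_eq (hu : IsUnitCancellative H) {c : H} {z : Multiset H}
    (hz : ∀ u ∈ z, Irreducible u) (h : c = c * z.prod) : z = 0 := by
  by_contra hz0
  obtain ⟨u, hu'⟩ := Multiset.exists_mem_of_ne_zero hz0
  exact (hz u hu').not_isUnit (isUnit_of_dvd_unit (Multiset.dvd_prod hu') (hu _ _ h))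

/-- Pairs of multisets of atoms in `E` whose products agree in the quotient group of `H`. -/
def stablePairs (E : Set H) : Set (Multiset H × Multiset H) :=
  {p | p.1 ∈ atomMultisets E ∧ p.2 ∈ atomMultisets E ∧ ∃ c : H, c * p.1.prod = c * p.2.prod}

/-- Among all nontrivial pairs in `stablePairs E` there is one with maximal quotient of lengths.
Indeed the pairs are closed under differences, so that each pair is a sum of minimal ones, and of
the latter there are only finitely many. -/
theorem exists_maximal_quotient (hE : E.Finite) (hu : IsUnitCancellative H)
    (hne : ∃ p ∈ stablePairs E, p ≠ 0) :
    ∃ p ∈ stablePairs E, 0 < Multiset.card p.1 ∧ ∀ p' ∈ stablePairs E,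
      Multiset.card p'.2 * Multiset.card p.1 ≤ Multiset.card p'.1 * Multiset.card p.2 := by
  have hpos : ∀ p ∈ stablePairs E, p ≠ 0 → 0 < Multiset.card p.1 := by
    rintro ⟨x, y⟩ ⟨hx, hy, c, hc⟩ hp
    rw [Multiset.card_pos]
    rintro rfl
    rw [Multiset.prod_zero, mul_one] at hc
    exact hp (Prod.ext rfl (hu.eq_zero_of_mul_eq (fun u hu => (hy u hu).2) hc))
  have hA : {p ∈ stablePairs E | p ≠ 0}.IsPWO :=
    ((isPWO_atomMultisets hE).prod (isPWO_atomMultisets hE)).mono fun p hp => ⟨hp.1.1, hp.1.2.1⟩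
  obtain ⟨F, hFA, hF, hmin⟩ := hA.exists_finite_forall_le
  obtain ⟨p₀, hp₀, hp₀'⟩ := hne
  obtain ⟨m₀, hm₀, -⟩ := hmin p₀ ⟨hp₀, hp₀'⟩
  obtain ⟨p, hpF, hpmax⟩ := Set.exists_max_image F
    (fun p => (Multiset.card p.2 / Multiset.card p.1 : ℚ)) hF ⟨m₀, hm₀⟩
  have hp0 := hpos p (hFA hpF).1 (hFA hpF).2
  refine ⟨p, (hFA hpF).1, hp0, fun p' hp' => ?_⟩
  induction hn : Multiset.card p'.1 using Nat.strong_induction_on generalizing p' with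
  | _ n ih =>
    by_cases h0 : p' = 0
    · simp [h0]
    obtain ⟨m, hm, hmp⟩ := hmin p' ⟨hp', h0⟩
    obtain ⟨w, rfl⟩ : ∃ w, p' = m + w := by
      obtain ⟨w₁, h1⟩ := Multiset.le_iff_exists_add.1 hmp.1
      obtain ⟨w₂, h2⟩ := Multiset.le_iff_exists_add.1 hmp.2
      exact ⟨(w₁, w₂), Prod.ext h1 h2⟩
    have hm0 := hpos m (hFA hm).1 (hFA hm).2
    have hw : w ∈ stablePairs E := by
      obtain ⟨h1, h2, c, hc⟩ := hp'
      obtain ⟨-, -, b, hb⟩ := (hFA hm).1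
      refine ⟨mem_atomMultisets_of_le h1 (Multiset.le_add_left _ _),
        mem_atomMultisets_of_le h2 (Multiset.le_add_left _ _), c * b * m.1.prod, ?_⟩
      simp only [Prod.fst_add, Prod.snd_add, Multiset.prod_add] at hc
      calc c * b * m.1.prod * w.1.prod = b * (c * (m.1.prod * w.1.prod)) := by
            ac_rfl
        _ = c * (b * m.2.prod) * w.2.prod := by rw [hc]; ac_rfl
        _ = c * b * m.1.prod * w.2.prod := by rw [← hb]; ac_rfl
    simp only [Prod.fst_add, Prod.snd_add, Multiset.card_add] at hn ⊢
    have h1 := ih _ (by omega) w hw rfl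
    have h2 := hpmax m hm
    rw [div_le_div_iff₀ (by exact_mod_cast hm0) (by exact_mod_cast hp0)] at h2
    have h3 : Multiset.card m.2 * Multiset.card p.1 ≤ Multiset.card p.2 * Multiset.card m.1 := by
      exact_mod_cast h2
    rw [← hn]
    nlinarith

theorem PrimeOutside.structureTheoremForUnions [Subsingleton Hˣ] (hE : PrimeOutside E)
    (hu : IsUnitCancellative H) (hat : IsAtomic H) : StructureTheoremForUnions H := by
  by_cases hunit : ∀ a : H, IsUnit a
  · refine ⟨1, one_pos, 0, 0, fun k _ => ⟨k, ∅, {0}, ∅, ?_, by simp, by simp,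
      Or.inl ⟨0, ?_, by simp⟩⟩⟩
    · have : unionOfLengths H k = {k} := by
        ext l
        exact ⟨fun hl => hl.elim And.right fun h => absurd (hunit _) h.1.choose_spec,
          fun hl => Or.inl ⟨hunit, hl⟩⟩
      simp [this]
    · ext x
      simp
  have hunit' := hunit
  push Not at hunit'
  obtain ⟨b, hb⟩ := hunit'
  obtain ⟨u, hu'⟩ : ∃ u : H, Irreducible u := by
    obtain ⟨z, hz, rfl⟩ := hat b hb
    have hz0 : z ≠ 0 := by
      rintro rfl
      simp at hb
    obtain ⟨u, hu⟩ := Multiset.exists_mem_of_ne_zero hz0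
    exact ⟨u, hz u hu⟩
  let W : ℕ → ℕ → Prop := fun k l => ∃ a : H, k ∈ lengths a ∧ l ∈ lengths a
  have hU : ∀ k, unionOfLengths H k = {l | W k l} := fun k => by
    ext l
    simp only [unionOfLengths, hunit, false_and, false_or, Set.mem_ofPred_eq, W]
    exact and_iff_right ⟨b, hb⟩
  have hrefl : ∀ k, W k k := fun k => by
    have : k ∈ lengths (u ^ k) := ⟨Multiset.replicate k u, ⟨fun v hv => by
      rwa [Multiset.eq_of_mem_replicate hv], Multiset.prod_replicate _ _⟩,
      Multiset.card_replicate _ _⟩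
    exact ⟨u ^ k, this, this⟩
  have hsymm : ∀ k l, W k l → W l k := fun k l ⟨a, hk, hl⟩ => ⟨a, hl, hk⟩
  have hadd : ∀ k l k' l', W k l → W k' l' → W (k + k') (l + l') := by
    rintro _ _ _ _ ⟨a, ⟨x, hx, rfl⟩, ⟨y, hy, rfl⟩⟩ ⟨a', ⟨x', hx', rfl⟩, ⟨y', hy', rfl⟩⟩
    exact ⟨a * a', ⟨x + x', add_mem_factorizations hx hx', Multiset.card_add _ _⟩,
      ⟨y + y', add_mem_factorizations hy hy', Multiset.card_add _ _⟩⟩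
  have hfac : ∀ c : H, ∃ z, z ∈ factorizations c := fun c => by
    by_cases hc : IsUnit c
    · exact ⟨0, by simp, by simpa using (isUnit_iff_eq_one.1 hc).symm⟩
    · exact hat c hc
  obtain ⟨g, h, c, hg, hgh, hray, hcone⟩ : ∃ g h c : ℕ, 0 < g ∧ g ≤ h ∧
      (∀ q : ℕ, W (c + q * g) (c + q * h)) ∧ ∀ p ∈ stablePairs E,
        Multiset.card p.2 * g ≤ Multiset.card p.1 * h := by
    by_cases hne : ∃ p ∈ stablePairs E, p ≠ 0
    · obtain ⟨p, hp, hp0, hmax⟩ := exists_maximal_quotient hE.finite hu hne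
      obtain ⟨h1, h2, c, hc⟩ := hp
      obtain ⟨zc, hzc⟩ := hfac c
      refine ⟨_, _, Multiset.card zc, hp0, ?_, fun q => ?_, hmax⟩
      · have := hmax (p.1, p.1) ⟨h1, h1, 1, rfl⟩
        exact Nat.le_of_mul_le_mul_left this hp0
      · have hq : c * p.1.prod ^ q = c * p.2.prod ^ q := by
          induction q with
          | zero => rw [pow_zero, pow_zero]
          | succ q ih =>
            rw [pow_succ, ← mul_assoc, ih, mul_right_comm, hc, mul_right_comm, mul_assoc,
              ← pow_succ]
        refine ⟨c * p.1.prod ^ q, ⟨zc + q • p.1, ?_, by simp⟩, ⟨zc + q • p.2, ?_, by simp⟩⟩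
        · exact add_mem_factorizations hzc ⟨fun v hv => (h1 v (Multiset.mem_of_mem_nsmul hv)).2,
            Multiset.prod_nsmul _ _⟩
        · rw [hq]
          exact add_mem_factorizations hzc ⟨fun v hv => (h2 v (Multiset.mem_of_mem_nsmul hv)).2,
            Multiset.prod_nsmul _ _⟩
    · push Not at hne
      refine ⟨1, 1, 0, one_pos, le_rfl, fun q => hrefl _, fun p hp => ?_⟩
      simp [hne p hp]
  have hcone' : ∀ k l, W k l → l * g ≤ k * h := by
    rintro _ _ ⟨a, ⟨x, hx, rfl⟩, ⟨y, hy, rfl⟩⟩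
    obtain ⟨p, x', y', rfl, rfl, hx', hy', hprod⟩ :=
      hE.exists_eq_add hx.1 hy.1 (hx.2.trans hy.2.symm)
    have h1 := hcone (x', y') ⟨hx', hy', 1, by simpa using hprod⟩
    have h2 := Nat.mul_le_mul_left (Multiset.card p) hgh
    rw [Multiset.card_add, Multiset.card_add, add_mul, add_mul]
    exact Nat.add_le_add h2 h1
  obtain ⟨d, hd, M, k₀, hk₀⟩ := exists_progression_of_cone hrefl hsymm hadd hg hray hcone'
  refine ⟨d, hd, M, k₀, fun k hk => ?_⟩
  obtain ⟨y, L', L, L'', h1, h2, h3, h4⟩ := hk₀ k hk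
  exact ⟨y, L', L, L'', by rw [hU, h1], h2, h3, Or.inl h4⟩

end Factorization

/-! ### Arithmetic of the monoid of nonzero `r`-ideals -/

theorem theorem4p15 {R : Type*} [CommRing R] [IsDomain R] (r : IdealSystem R)
    (hcond : completeConductor R ≠ ⊥)
    (hnoeth : r.IsRNoetherian)
    (hmax : r.rMax = minimalNonzeroPrimes R)
    (hfin : {I : r.NonzeroRIdeal | Irreducible I ∧ completeConductor R ≤ I.1.radical}.Finite) :
    (Factorization.IsUnitCancellative r.NonzeroRIdeal ∧
      Factorization.IsAtomic r.NonzeroRIdeal) ∧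
    (Factorization.monotoneCatenaryDegree r.NonzeroRIdeal < ⊤ ∧
      Factorization.successiveDistance r.NonzeroRIdeal < ⊤ ∧
      Factorization.catenaryDegree r.NonzeroRIdeal < ⊤ ∧
      (Factorization.distances r.NonzeroRIdeal).Finite) ∧
    Factorization.StructureTheoremForUnions r.NonzeroRIdeal := by
  have hcanc := IdealSystem.NonzeroRIdeal.isUnitCancellative hnoeth hmax
  have hatomic := IdealSystem.NonzeroRIdeal.isAtomic hnoeth hcanc
  have hE : Factorization.PrimeOutside {I : r.NonzeroRIdeal |
      Irreducible I ∧ completeConductor R ≤ I.1.radical} :=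
    { finite := hfin
      dvd_or_dvd := fun p hp hpE => (IdealSystem.NonzeroRIdeal.dvd_or_dvd_and_cancel_of_irreducible
        hnoeth hmax hp fun hc => hpE ⟨hp, hc⟩).1
      cancel := fun p hp hpE => (IdealSystem.NonzeroRIdeal.dvd_or_dvd_and_cancel_of_irreducible
        hnoeth hmax hp fun hc => hpE ⟨hp, hc⟩).2 }
  exact ⟨⟨hcanc, hatomic⟩, ⟨hE.monotoneCatenaryDegree_lt_top, hE.successiveDistance_lt_top,
    hE.catenaryDegree_lt_top, hE.finite_distances⟩, hE.structureTheoremForUnions hcanc hatomic⟩
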